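/- Let $Q=[-1,1]^3$, let $\partial Q$ be its surface, and let $S=(s_1,s_2,-1)$ and $T=(t_1,t_2,1)$ with $|s_1|,|s_2|,|t_1|,|t_2|<1$ be points in the interiors of the bottom (source) and the top (target) face. A shortest path from $S$ to $T$ is a continuous path on $\partial Q$ from $S$ to $T$ of minimal length among all such paths, and $d(S,T)$ denotes the infimum of the lengths of all such paths. The cube stands with its bottom face on the base square $[-1,1]^2$ of the plane. A finite sequence $w$ of letters R, L, U, D is a roll sequence: the cube is rolled over its bottom edges successively in the directions $+x,-x,+y,-y$ given by the letters. At the start and after each roll, one face of the cube touches a square of the plane, and each point of that face is unfolded to the point of the plane that it touches. The sequence $w$ gives a partial unfolding (from the source face to the target face) if the faces that touch the plane at the start and after each roll are pairwise distinct and the last one is the target face; the partial unfolding is the union of the corresponding squares. Let $T_w$ be the point of the last square to which $T$ is unfolded. The straight segment from $(s_1,s_2)$ to $T_w$ is an LS-path if $w$ gives a partial unfolding and the segment is contained in the interior of this union; its length is $\ell_w=|(s_1,s_2)-T_w|$. The unfolding grid consists of the twelve roll sequences RR, RUR, RDR, LL, LUL, LDL, UU, URU, ULU, DD, DRD, DLD.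 Then: 1. A shortest path from $S$ to $T$ exists, and for every shortest path there is a roll sequence $w$ of the unfolding grid such that the segment from $(s_1,s_2)$ to $T_w$ is an LS-path and the shortest path, unfolded in the partial unfolding given by $w$, is this segment, run through monotonically from $(s_1,s_2)$ to $T_w$. 2. $d(S,T)$ is the minimum of $\ell_w$ over all $w$ for which the segment is an LS-path. It is also the minimum of $\ell_w$ over those of the twelve roll sequences $w$ of the unfolding grid for which the segment is an LS-path, and the minimum of $\ell_w$ over all twelve roll sequences of the unfolding grid. -/

import Mathlib

open Set
open scoped ENNReal unitInterval

noncomputable section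

namespace CubeUnfolding

abbrev Space : Type := EuclideanSpace ℝ (Fin 3)

abbrev Plane : Type := EuclideanSpace ℝ (Fin 2)

/-- The surface of the cube `[-1, 1]³`. -/
def cubeSurface : Set Space :=
  {q | (∀ i, |q i| ≤ 1) ∧ ∃ i, |q i| = 1}

/-- The source face is the bottom face `z = -1`; this is its relative interior. -/
def openSourceFace : Set Space :=
  {q | q 2 = -1 ∧ |q 0| < 1 ∧ |q 1| < 1}

/-- The target face is the top face `z = 1`. -/
def targetFace : Set Space :=
  {q | q ∈ cubeSurface ∧ q 2 = 1}

/-- The relative interior of the target face. -/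
def openTargetFace : Set Space :=
  {q | q 2 = 1 ∧ |q 0| < 1 ∧ |q 1| < 1}

/-! Paths on the cube surface -/

/-- The path stays on the surface of the cube. -/
def IsSurfacePath {S T : Space} (γ : Path S T) : Prop :=
  ∀ t, γ t ∈ cubeSurface

/-- The length of a path in space (its total variation, possibly infinite). -/
def pathLength {S T : Space} (γ : Path S T) : ℝ≥0∞ :=
  eVariationOn γ univ

/-- A shortest path on the surface, among all continuous surface paths with the same ends. -/
def IsShortestPath {S T : Space} (γ : Path S T) : Prop :=
  IsSurfacePath γ ∧ ∀ γ' : Path S T, IsSurfacePath γ' → pathLength γ ≤ pathLength γ'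

/-- The shortest distance on the surface: the infimum of the lengths of surface paths. -/
def surfaceDist (S T : Space) : ℝ≥0∞ :=
  ⨅ (γ : Path S T) (_ : IsSurfacePath γ), pathLength γ

/-! Rolling the cube on the plane `z = -1` -/

/-- The directions right (`+x`), left (`-x`), up (`+y`), down (`-y`). -/
inductive Dir
  | R
  | L
  | U
  | D

/-- The quarter turn of the cube about its centre that occurs when it is rolled in the given
direction: rolling right takes the top face to the right and the right face to the bottom. -/
def turn : Dir → Space → Space
  | Dir.R, q => !₂[q 2, q 1, -q 0]
  | Dir.L, q => !₂[-q 2, q 1, q 0]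
  | Dir.U, q => !₂[q 0, q 2, -q 1]
  | Dir.D, q => !₂[q 0, -q 2, q 1]

/-- The displacement of the centre of the cube (which has side 2) in one roll. -/
def shift : Dir → Space
  | Dir.R => !₂[2, 0, 0]
  | Dir.L => !₂[-2, 0, 0]
  | Dir.U => !₂[0, 2, 0]
  | Dir.D => !₂[0, -2, 0]

/-- `rolled w q` is the position, after performing the sequence of rolls `w` (read from left to
right), of the point of the cube that was initially at `q`. A roll is the quarter turn about a
bottom edge of the cube, that is, a quarter turn about the centre followed by `shift`; later
rolls are not affected by the horizontal translation. -/
def rolled : List Dir → Space → Space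
  | [], q => q
  | d :: w, q => rolled w (turn d q) + shift d

/-- The planar position of the point `q` of the cube after the rolls `w`. -/
def imprint (w : List Dir) (q : Space) : Plane :=
  !₂[rolled w q 0, rolled w q 1]

/-- The face of the (original) cube that is in contact with the plane after the rolls `w`. -/
def contactFace (w : List Dir) : Set Space :=
  {q | q ∈ cubeSurface ∧ rolled w q 2 = -1}

/-- The (closed) grid square on which the cube rests after the rolls `w`. -/
def square (w : List Dir) : Set Plane :=
  imprint w '' contactFace w

/-! Unfoldings. The faces rolled over in `w` are the contact faces of the prefixes of `w`. -/

/-- The roll sequence `w` gives a partial unfolding from the source face to the target face: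
no face of the cube occurs twice, and the last face is the target face. -/
def IsPartialUnfolding (w : List Dir) : Prop :=
  (∀ v₁ v₂, v₁ <+: w → v₂ <+: w → contactFace v₁ = contactFace v₂ → v₁ = v₂) ∧
    contactFace w = targetFace

/-- The planar region covered by the squares of the partial unfolding. -/
def region (w : List Dir) : Set Plane :=
  ⋃ v ∈ {v : List Dir | v <+: w}, square v

/-- The straight line from the source point in the base square to the image of the target point
in the last square lies in the interior of the partial unfolding `w`. -/
def IsLSPath (S T : Space) (w : List Dir) : Prop :=
  IsPartialUnfolding w ∧ segment ℝ (imprint [] S) (imprint w T) ⊆ interior (region w)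

/-- The length of the straight line from the source point to the unfolded target point. -/
def lineLength (S T : Space) (w : List Dir) : ℝ≥0∞ :=
  ENNReal.ofReal (dist (imprint [] S) (imprint w T))

/-- The point `q` of the surface unfolds to the point `p` of the plane, in one of the squares of
the partial unfolding `w`. -/
def UnfoldsTo (w : List Dir) (q : Space) (p : Plane) : Prop :=
  ∃ v, v <+: w ∧ q ∈ contactFace v ∧ imprint v q = p

/-- In the partial unfolding `w`, the path `γ` on the surface unfolds to the straight line from
the source point to the image of the target point, run through monotonically. -/
def UnfoldsToLine {S T : Space} (γ : Path S T) (w : List Dir) : Prop :=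
  ∃ φ : I → I, Monotone φ ∧ Continuous φ ∧ φ 0 = 0 ∧ φ 1 = 1 ∧
    ∀ t, UnfoldsTo w (γ t)
      (AffineMap.lineMap (imprint [] S) (imprint w T) ((φ t : I) : ℝ))

open Dir in
/-- The twelve roll sequences of the unfolding grid. -/
def unfoldingGrid : Set (List Dir) :=
  {[R, R], [R, U, R], [R, D, R],
   [L, L], [L, U, L], [L, D, L],
   [U, U], [U, R, U], [U, L, U],
   [D, D], [D, R, D], [D, L, D]}

end CubeUnfolding

end

open CubeUnfolding

/-! Both bounds come from maps that do not increase the length of curves.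

Lower bound. A surface path has a stretch on the lateral faces, from the last time at height -1 to
the first later time at height 1. This stretch is developed by a planar map that is 1-Lipschitz on
each lateral face, what precedes by `imprint []` and what follows by `imprint w`. The latter two are
1-Lipschitz on all of space, so it does not matter where the path goes outside the stretch. The
three images join to a planar curve from the source to the unfolded target, so the path is at least
as long as the segment (`IsCrossing.hasGridBound_of_development`). Up to reflections the stretch
starts on the edge `x = 1` of the source face. If it ends on the edge `x = 1` of the target face,
`w` is RR; on `y = 1`, RUR; on `x = -1`, the path is at least as long as the segment of RUUR (or
RDDR), which is strictly longer than that of UU (or DD). In the case of equality, strict convexity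
makes the planar curve the segment, run through monotonically (`DominatedOn.exists_lineMap`), and
keeps the path in the faces that `w` unfolds.

Upper bound. Take the shortest of the twelve segments. One of type RR always lies in the interior of
its region. One of type RUR could only fail to do so at the reflex corners (1,1) and (3,1), and the
comparisons with UU and RR exclude this. The segment is folded back to a surface path by a
continuous map that is isometric on each square (`exists_path_of_fold`).

Other partial unfoldings. A finite enumeration leaves sixteen, of the types RUUR and RUUUR up to
symmetry; none has a segment shorter than all those of the grid. -/

noncomputable section

namespace CubeUnfolding

/-! ### Comparison of the lengths of curves -/

/-- The displacements of `g` are at most the lengths of the corresponding pieces of `f`. -/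
def DominatedOn {E F : Type*} [PseudoEMetricSpace E] [PseudoEMetricSpace F]
    (g : I → F) (f : I → E) (a b : I) : Prop :=
  ∀ s t, a ≤ s → s ≤ t → t ≤ b → edist (g s) (g t) ≤ eVariationOn f (Icc s t)

section Domination

variable {E F : Type*} [PseudoEMetricSpace E] [PseudoEMetricSpace F]

theorem eVariationOn_Icc_add (f : I → E) {a b c : I} (hab : a ≤ b) (hbc : b ≤ c) :
    eVariationOn f (Icc a b) + eVariationOn f (Icc b c) = eVariationOn f (Icc a c) := by
  simpa using eVariationOn.Icc_add_Icc f (s := univ) hab hbc (mem_univ b)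

theorem edist_le_eVariationOn_Icc (f : I → E) {s t : I} (h : s ≤ t) :
    edist (f s) (f t) ≤ eVariationOn f (Icc s t) :=
  eVariationOn.edist_le f (left_mem_Icc.2 h) (right_mem_Icc.2 h)

theorem DominatedOn.trans {g : I → F} {f : I → E} {a m b : I}
    (h₁ : DominatedOn g f a m) (h₂ : DominatedOn g f m b) : DominatedOn g f a b := by
  intro s t has hst htb
  rcases le_total t m with htm | hmt
  · exact h₁ s t has hst htm
  rcases le_total m s with hms | hsm
  · exact h₂ s t hms hst htb
  rw [← eVariationOn_Icc_add f hsm hmt]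
  exact (edist_triangle _ (g m) _).trans
    (add_le_add (h₁ s m has hsm le_rfl) (h₂ m t le_rfl hmt htb))

theorem DominatedOn.congr {g g' : I → F} {f : I → E} {a b : I} (h : DominatedOn g f a b)
    (hg : ∀ t, a ≤ t → t ≤ b → g' t = g t) : DominatedOn g' f a b := by
  intro s t has hst htb
  rw [hg s has (hst.trans htb), hg t (has.trans hst) htb]
  exact h s t has hst htb

theorem DominatedOn.of_edist_le {g : I → F} {f : I → E} (a b : I)
    (h : ∀ s t, edist (g s) (g t) ≤ edist (f s) (f t)) : DominatedOn g f a b :=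
  fun s t _ hst _ => (h s t).trans (edist_le_eVariationOn_Icc f hst)

theorem DominatedOn.eVariationOn_le {g : I → F} {f : I → E} (h : DominatedOn g f 0 1) :
    eVariationOn g univ ≤ eVariationOn f univ := by
  refine iSup_le fun p => ?_
  obtain ⟨n, u, hu, -⟩ := p
  calc ∑ i ∈ Finset.range n, edist (g (u (i + 1))) (g (u i))
      ≤ ∑ i ∈ Finset.range n, eVariationOn f (Icc (u i) (u (i + 1))) := by
        refine Finset.sum_le_sum fun i _ => ?_
        rw [edist_comm]
        exact h _ _ unitInterval.nonneg' (hu i.le_succ) unitInterval.le_one'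
    _ = eVariationOn f (Icc (u 0) (u n)) := eVariationOn.sum' f hu
    _ ≤ eVariationOn f univ := eVariationOn.mono f (subset_univ _)

end Domination

/-- A map that is 1-Lipschitz on each of finitely many closed pieces does not increase the length
of a curve that stays in these pieces. -/
theorem edist_comp_le_eVariationOn {E F : Type*} [PseudoEMetricSpace E] [PseudoEMetricSpace F]
    {c : I → E} (hc : Continuous c) {Φ : E → F} (P : Finset (Set E)) :
    (∀ A ∈ P, IsClosed A) → (∀ A ∈ P, ∀ x ∈ A, ∀ y ∈ A, edist (Φ x) (Φ y) ≤ edist x y) →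
    ∀ s t, s ≤ t → (∀ r ∈ Icc s t, ∃ A ∈ P, c r ∈ A) →
      edist (Φ (c s)) (Φ (c t)) ≤ eVariationOn c (Icc s t) := by
  classical
  induction P using Finset.strongInduction with
  | H P ih =>
    intro hcl hΦ s t hst hcov
    obtain ⟨A, hAP, hsA⟩ := hcov s (left_mem_Icc.2 hst)
    -- `r` is the last time in `A`. Up to `r` the bound on `A` applies to the two ends, wherever the
    -- curve goes in between; after `r` the other pieces suffice.
    obtain ⟨r, ⟨⟨hsr, hrt⟩, hrA⟩, hr⟩ :=
      ((isCompact_Icc (a := s) (b := t)).inter_right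
        ((hcl A hAP).preimage hc)).exists_isGreatest ⟨s, left_mem_Icc.2 hst, hsA⟩
    have h₁ : edist (Φ (c s)) (Φ (c r)) ≤ eVariationOn c (Icc s r) :=
      (hΦ A hAP _ hsA _ hrA).trans (edist_le_eVariationOn_Icc c hsr)
    rcases hrt.eq_or_lt with rfl | hlt
    · exact h₁
    -- At the time `r` itself the other pieces are reached because their union is closed.
    have hsub : Icc r t ⊆ c ⁻¹' ⋃ B ∈ P.erase A, B := by
      rw [← closure_Ioc hlt.ne]
      refine closure_minimal ?_ (IsClosed.preimage hc ?_)
      · rintro x ⟨hrx, hxt⟩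
        obtain ⟨B, hB, hxB⟩ := hcov x ⟨hsr.trans hrx.le, hxt⟩
        have hBA : B ≠ A := by
          rintro rfl
          exact absurd (hr ⟨⟨hsr.trans hrx.le, hxt⟩, hxB⟩) (not_le.2 hrx)
        exact mem_biUnion (Finset.mem_coe.2 (Finset.mem_erase.2 ⟨hBA, hB⟩)) hxB
      · exact (P.erase A).finite_toSet.isClosed_biUnion
          fun B hB => hcl B (Finset.mem_of_mem_erase hB)
    have h₂ := ih _ (Finset.erase_ssubset hAP) (fun B hB => hcl B (Finset.mem_of_mem_erase hB))
      (fun B hB => hΦ B (Finset.mem_of_mem_erase hB)) r t hrt (fun x hx => by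
        simpa using hsub hx)
    rw [← eVariationOn_Icc_add c hsr hrt]
    exact (edist_triangle _ _ _).trans (add_le_add h₁ h₂)

/-! ### The case of equality -/

section Rigidity

variable {V : Type*} [NormedAddCommGroup V] [NormedSpace ℝ V] [StrictConvexSpace ℝ V]

theorem wbtw_of_edist_add_le {x y z : V} (h : edist x y + edist y z ≤ edist x z) :
    Wbtw ℝ x y z := by
  rw [← dist_add_dist_eq_iff]
  refine le_antisymm ?_ (dist_triangle _ _ _)
  rw [edist_dist, edist_dist, edist_dist, ← ENNReal.ofReal_add dist_nonneg dist_nonneg] at h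
  exact (ENNReal.ofReal_le_ofReal_iff dist_nonneg).1 h

/-- The lengths before `s` and after `t` are already at least the displacements of `g` there, so
excess length between `s` and `t` would make the whole curve too long. -/
theorem DominatedOn.eVariationOn_le_edist {E F : Type*} [PseudoEMetricSpace E]
    [PseudoMetricSpace F] {g : I → F} {f : I → E} (h : DominatedOn g f 0 1)
    (hf : eVariationOn f univ ≤ edist (g 0) (g 1)) {s t : I} (hst : s ≤ t) :
    eVariationOn f (Icc s t) ≤ edist (g s) (g t) := by
  have h0 : (0 : I) ≤ s := unitInterval.nonneg'
  have h1 : t ≤ (1 : I) := unitInterval.le_one'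
  have e : eVariationOn f (Icc 0 s) + eVariationOn f (Icc s t) + eVariationOn f (Icc t 1) =
      eVariationOn f univ := by
    rw [eVariationOn_Icc_add f h0 hst, eVariationOn_Icc_add f (h0.trans hst) h1]
    congr 1
    ext x
    simp [unitInterval.le_one']
  have hfin : eVariationOn f univ ≠ ∞ := ne_top_of_le_ne_top (edist_ne_top _ _) hf
  -- Finiteness permits the cancellation in `ℝ≥0∞` below.
  have fin : ∀ a b : I, eVariationOn f (Icc a b) ≠ ∞ := fun a b =>
    ne_top_of_le_ne_top hfin (eVariationOn.mono f (subset_univ _))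
  have key : eVariationOn f (Icc 0 s) + eVariationOn f (Icc s t) + eVariationOn f (Icc t 1) ≤
      eVariationOn f (Icc 0 s) + edist (g s) (g t) + eVariationOn f (Icc t 1) := by
    rw [e]
    refine hf.trans ((edist_triangle4 _ (g s) (g t) _).trans ?_)
    gcongr
    · exact h 0 s le_rfl h0 (hst.trans h1)
    · exact h t 1 (h0.trans hst) h1 le_rfl
  rw [ENNReal.add_le_add_iff_right (fin t 1), ENNReal.add_le_add_iff_left (fin 0 s)] at key
  exact key

/-- If the length of a piece of a curve is the distance of its ends, it stays on the segment. -/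
theorem mem_segment_of_eVariationOn_le {f : I → V} {a b t : I}
    (h : eVariationOn f (Icc a b) ≤ edist (f a) (f b)) (hat : a ≤ t) (htb : t ≤ b) :
    f t ∈ segment ℝ (f a) (f b) := by
  rw [mem_segment_iff_wbtw]
  refine wbtw_of_edist_add_le (le_trans ?_ h)
  rw [← eVariationOn_Icc_add f hat htb]
  exact add_le_add (edist_le_eVariationOn_Icc f hat) (edist_le_eVariationOn_Icc f htb)

/-- If a curve is as short as the distance of the ends of a curve that it dominates, the latter is
a segment that is run through monotonically. -/
theorem DominatedOn.exists_lineMap {E : Type*} [PseudoEMetricSpace E] {g : I → V} {f : I → E}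
    (h : DominatedOn g f 0 1) (hf : eVariationOn f univ ≤ edist (g 0) (g 1))
    (hg : Continuous g) (hne : g 0 ≠ g 1) :
    ∃ φ : I → I, Monotone φ ∧ Continuous φ ∧ φ 0 = 0 ∧ φ 1 = 1 ∧
      ∀ t, g t = AffineMap.lineMap (g 0) (g 1) ((φ t : I) : ℝ) := by
  have hd : 0 < dist (g 0) (g 1) := dist_pos.2 hne
  have hsum : ∀ s t u, s ≤ t → t ≤ u → dist (g s) (g t) + dist (g t) (g u) = dist (g s) (g u) := by
    intro s t u hst htu
    rw [dist_add_dist_eq_iff]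
    refine wbtw_of_edist_add_le (le_trans ?_ (h.eVariationOn_le_edist hf (hst.trans htu)))
    rw [← eVariationOn_Icc_add f hst htu]
    exact add_le_add (h s t unitInterval.nonneg' hst unitInterval.le_one')
      (h t u unitInterval.nonneg' htu unitInterval.le_one')
  have hle : ∀ t, dist (g 0) (g t) / dist (g 0) (g 1) ≤ 1 := fun t => by
    rw [div_le_one hd]
    have := hsum 0 t 1 unitInterval.nonneg' unitInterval.le_one'
    linarith [dist_nonneg (x := g t) (y := g 1)]
  refine ⟨fun t => ⟨dist (g 0) (g t) / dist (g 0) (g 1), by positivity, hle t⟩, ?_, ?_, ?_, ?_, ?_⟩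
  · intro s t hst
    have := hsum 0 s t unitInterval.nonneg' hst
    have h' : dist (g 0) (g s) ≤ dist (g 0) (g t) := by
      linarith [dist_nonneg (x := g s) (y := g t)]
    exact div_le_div_of_nonneg_right h' hd.le
  · exact Continuous.subtype_mk (by fun_prop) _
  · simp
  · ext
    simp [hd.ne']
  · intro t
    have hw : Wbtw ℝ (g 0) (g t) (g 1) :=
      dist_add_dist_eq_iff.1 (hsum 0 t 1 unitInterval.nonneg' unitInterval.le_one')
    obtain ⟨r, hr, hrt⟩ := hw
    have : dist (g 0) (g t) / dist (g 0) (g 1) = r := by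
      rw [← hrt, dist_left_lineMap, Real.norm_of_nonneg hr.1]
      field_simp
    simp only [this, hrt]

end Rigidity

/-! ### Coordinates and symmetries of the cube -/

theorem space_ext {p q : Space} (h0 : p 0 = q 0) (h1 : p 1 = q 1) (h2 : p 2 = q 2) : p = q := by
  ext i
  fin_cases i <;> assumption

theorem plane_ext {p q : Plane} (h0 : p 0 = q 0) (h1 : p 1 = q 1) : p = q := by
  ext i
  fin_cases i <;> assumption

theorem mem_cubeSurface {q : Space} : q ∈ cubeSurface ↔
    (|q 0| ≤ 1 ∧ |q 1| ≤ 1 ∧ |q 2| ≤ 1) ∧ (|q 0| = 1 ∨ |q 1| = 1 ∨ |q 2| = 1) := by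
  simp [cubeSurface, Fin.forall_fin_succ, Fin.exists_fin_succ]

/-- An involutive symmetry of the cube that fixes the source face and the target face. -/
structure CubeSymmetry where
  dir : Dir → Dir
  space : Space ≃ₗᵢ[ℝ] Space
  plane : Plane ≃ₗᵢ[ℝ] Plane
  dir_dir : ∀ d, dir (dir d) = d
  space_space : ∀ q, space (space q) = q
  turn_dir : ∀ d q, turn (dir d) (space q) = space (turn d q)
  shift_dir : ∀ d, shift (dir d) = space (shift d)
  plane_space : ∀ q : Space, plane !₂[q 0, q 1] = !₂[space q 0, space q 1]
  space_two : ∀ q, space q 2 = q 2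
  space_mem : ∀ {q}, q ∈ cubeSurface → space q ∈ cubeSurface
  space_side : ∀ {q}, (|q 0| = 1 ∨ |q 1| = 1) → |space q 0| = 1 ∨ |space q 1| = 1
  source : ∀ {q}, q ∈ openSourceFace → space q ∈ openSourceFace
  target : ∀ {q}, q ∈ openTargetFace → space q ∈ openTargetFace
  grid : ∀ {w}, w ∈ unfoldingGrid → w.map dir ∈ unfoldingGrid

/-- A linear involution that preserves norms. -/
def linearInvolution {n : ℕ} (f : EuclideanSpace ℝ (Fin n) →ₗ[ℝ] EuclideanSpace ℝ (Fin n))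
    (hf : Function.Involutive f) (hn : ∀ q, ‖f q‖ = ‖q‖) :
    EuclideanSpace ℝ (Fin n) ≃ₗᵢ[ℝ] EuclideanSpace ℝ (Fin n) :=
  { LinearEquiv.ofInvolutive f hf with norm_map' := hn }

namespace CubeSymmetry

/-- The reflection that exchanges the first two coordinates. -/
def swap : CubeSymmetry where
  dir
    | Dir.R => Dir.U
    | Dir.U => Dir.R
    | Dir.L => Dir.D
    | Dir.D => Dir.L
  space := linearInvolution
    { toFun := fun q => !₂[q 1, q 0, q 2]
      map_add' := fun p q => space_ext rfl rfl rfl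
      map_smul' := fun c q => space_ext rfl rfl rfl }
    (fun q => space_ext rfl rfl rfl)
    (fun q => by simp [EuclideanSpace.norm_eq, Fin.sum_univ_succ]; ring_nf)
  plane := linearInvolution
    { toFun := fun q => !₂[q 1, q 0]
      map_add' := fun p q => plane_ext rfl rfl
      map_smul' := fun c q => plane_ext rfl rfl }
    (fun q => plane_ext rfl rfl)
    (fun q => by simp [EuclideanSpace.norm_eq]; ring_nf)
  dir_dir d := by cases d <;> rfl
  space_space q := space_ext rfl rfl rfl
  turn_dir d q := by cases d <;> exact space_ext rfl rfl rfl
  shift_dir d := by cases d <;> exact space_ext rfl rfl rfl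
  plane_space q := plane_ext rfl rfl
  space_two q := rfl
  space_mem {q} hq := by
    rw [mem_cubeSurface] at hq ⊢
    change (|q 1| ≤ 1 ∧ |q 0| ≤ 1 ∧ |q 2| ≤ 1) ∧ (|q 1| = 1 ∨ |q 0| = 1 ∨ |q 2| = 1)
    tauto
  space_side h := h.symm
  source {q} hq := ⟨hq.1, hq.2.2, hq.2.1⟩
  target {q} hq := ⟨hq.1, hq.2.2, hq.2.1⟩
  grid {w} hw := by
    simp only [unfoldingGrid, mem_insert_iff, mem_singleton_iff] at hw
    rcases hw with h | h | h | h | h | h | h | h | h | h | h | h <;> subst h <;>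
      simp [unfoldingGrid]

/-- The reflection that changes the sign of the first coordinate. -/
def flipX : CubeSymmetry where
  dir
    | Dir.R => Dir.L
    | Dir.U => Dir.U
    | Dir.L => Dir.R
    | Dir.D => Dir.D
  space := linearInvolution
    { toFun := fun q => !₂[-q 0, q 1, q 2]
      map_add' := fun p q => space_ext (neg_add _ _) rfl rfl
      map_smul' := fun c q => space_ext (mul_neg _ _).symm rfl rfl }
    (fun q => space_ext (neg_neg _) rfl rfl)
    (fun q => by simp [EuclideanSpace.norm_eq, Fin.sum_univ_succ])
  plane := linearInvolution
    { toFun := fun q => !₂[-q 0, q 1]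
      map_add' := fun p q => plane_ext (neg_add _ _) rfl
      map_smul' := fun c q => plane_ext (mul_neg _ _).symm rfl }
    (fun q => plane_ext (neg_neg _) rfl)
    (fun q => by simp [EuclideanSpace.norm_eq])
  dir_dir d := by cases d <;> rfl
  space_space q := space_ext (neg_neg _) rfl rfl
  turn_dir d q := by
    cases d
    · exact space_ext rfl rfl rfl
    · exact space_ext (neg_neg _).symm rfl (neg_neg _)
    · exact space_ext rfl rfl rfl
    · exact space_ext rfl rfl rfl
  shift_dir d := by
    cases d
    · exact space_ext rfl rfl rfl
    · exact space_ext (neg_neg _).symm rfl rfl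
    · exact space_ext neg_zero.symm rfl rfl
    · exact space_ext neg_zero.symm rfl rfl
  plane_space q := plane_ext rfl rfl
  space_two q := rfl
  space_mem {q} hq := by
    rw [mem_cubeSurface] at hq ⊢
    change (|-q 0| ≤ 1 ∧ |q 1| ≤ 1 ∧ |q 2| ≤ 1) ∧ (|-q 0| = 1 ∨ |q 1| = 1 ∨ |q 2| = 1)
    rwa [abs_neg]
  space_side {q} h := h.imp_left (abs_neg (q 0)).trans
  source {q} hq := ⟨hq.1, (abs_neg (q 0)).trans_lt hq.2.1, hq.2.2⟩
  target {q} hq := ⟨hq.1, (abs_neg (q 0)).trans_lt hq.2.1, hq.2.2⟩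
  grid {w} hw := by
    simp only [unfoldingGrid, mem_insert_iff, mem_singleton_iff] at hw
    rcases hw with h | h | h | h | h | h | h | h | h | h | h | h <;> subst h <;>
      simp [unfoldingGrid]

/-- The reflection that changes the sign of the second coordinate. -/
def flipY : CubeSymmetry where
  dir
    | Dir.R => Dir.R
    | Dir.U => Dir.D
    | Dir.L => Dir.L
    | Dir.D => Dir.U
  space := linearInvolution
    { toFun := fun q => !₂[q 0, -q 1, q 2]
      map_add' := fun p q => space_ext rfl (neg_add _ _) rfl
      map_smul' := fun c q => space_ext rfl (mul_neg _ _).symm rfl }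
    (fun q => space_ext rfl (neg_neg _) rfl)
    (fun q => by simp [EuclideanSpace.norm_eq, Fin.sum_univ_succ])
  plane := linearInvolution
    { toFun := fun q => !₂[q 0, -q 1]
      map_add' := fun p q => plane_ext rfl (neg_add _ _)
      map_smul' := fun c q => plane_ext rfl (mul_neg _ _).symm }
    (fun q => plane_ext rfl (neg_neg _))
    (fun q => by simp [EuclideanSpace.norm_eq])
  dir_dir d := by cases d <;> rfl
  space_space q := space_ext rfl (neg_neg _) rfl
  turn_dir d q := by
    cases d
    · exact space_ext rfl rfl rfl
    · exact space_ext rfl rfl rfl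
    · exact space_ext rfl rfl rfl
    · exact space_ext rfl (neg_neg _).symm (neg_neg _)
  shift_dir d := by
    cases d
    · exact space_ext rfl neg_zero.symm rfl
    · exact space_ext rfl neg_zero.symm rfl
    · exact space_ext rfl rfl rfl
    · exact space_ext rfl (neg_neg _).symm rfl
  plane_space q := plane_ext rfl rfl
  space_two q := rfl
  space_mem {q} hq := by
    rw [mem_cubeSurface] at hq ⊢
    change (|q 0| ≤ 1 ∧ |-q 1| ≤ 1 ∧ |q 2| ≤ 1) ∧ (|q 0| = 1 ∨ |-q 1| = 1 ∨ |q 2| = 1)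
    rwa [abs_neg]
  space_side {q} h := h.imp_right (abs_neg (q 1)).trans
  source {q} hq := ⟨hq.1, hq.2.1, (abs_neg (q 1)).trans_lt hq.2.2⟩
  target {q} hq := ⟨hq.1, hq.2.1, (abs_neg (q 1)).trans_lt hq.2.2⟩
  grid {w} hw := by
    simp only [unfoldingGrid, mem_insert_iff, mem_singleton_iff] at hw
    rcases hw with h | h | h | h | h | h | h | h | h | h | h | h <;> subst h <;>
      simp [unfoldingGrid]

variable (g : CubeSymmetry)

theorem map_map (w : List Dir) : (w.map g.dir).map g.dir = w := by
  rw [List.map_map]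
  convert List.map_id w
  exact funext g.dir_dir

theorem rolled_map (w : List Dir) (q : Space) :
    rolled (w.map g.dir) (g.space q) = g.space (rolled w q) := by
  induction w generalizing q with
  | nil => rfl
  | cons d w ih => simp only [List.map_cons, rolled, g.turn_dir, ih, g.shift_dir, map_add]

theorem imprint_map (w : List Dir) (q : Space) :
    imprint (w.map g.dir) (g.space q) = g.plane (imprint w q) := by
  rw [imprint, imprint, rolled_map, g.plane_space]

theorem lineLength_map (S T : Space) (w : List Dir) :
    lineLength (g.space S) (g.space T) (w.map g.dir) = lineLength S T w := by
  have h := g.imprint_map [] S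
  rw [List.map_nil] at h
  rw [lineLength, lineLength, h, imprint_map, LinearIsometryEquiv.dist_map]

theorem mem_contactFace {w : List Dir} {q : Space} (h : q ∈ contactFace w) :
    g.space q ∈ contactFace (w.map g.dir) :=
  ⟨g.space_mem h.1, by rw [rolled_map, g.space_two, h.2]⟩

theorem contactFace_map (w : List Dir) :
    contactFace (w.map g.dir) = g.space '' contactFace w := by
  ext q
  constructor
  · intro h
    refine ⟨g.space q, ?_, g.space_space q⟩
    simpa only [g.map_map] using g.mem_contactFace h
  · rintro ⟨p, hp, rfl⟩
    exact g.mem_contactFace hp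

theorem image_targetFace : g.space '' targetFace = targetFace := by
  have h : ∀ q ∈ targetFace, g.space q ∈ targetFace := fun q hq =>
    ⟨g.space_mem hq.1, by rw [g.space_two, hq.2]⟩
  ext q
  constructor
  · rintro ⟨p, hp, rfl⟩
    exact h p hp
  · exact fun hq => ⟨g.space q, h q hq, g.space_space q⟩

theorem prefix_map {v w : List Dir} (h : v <+: w.map g.dir) : v.map g.dir <+: w := by
  simpa only [g.map_map] using h.map g.dir

theorem isPartialUnfolding_map {w : List Dir} (h : IsPartialUnfolding w) :
    IsPartialUnfolding (w.map g.dir) := by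
  refine ⟨fun v₁ v₂ h₁ h₂ e => ?_, ?_⟩
  · have := h.1 _ _ (g.prefix_map h₁) (g.prefix_map h₂) (by
      rw [contactFace_map, contactFace_map, e])
    rw [← g.map_map v₁, this, g.map_map]
  · rw [contactFace_map, h.2, image_targetFace]

theorem mem_region {w : List Dir} {p : Plane} (h : p ∈ region w) :
    g.plane p ∈ region (w.map g.dir) := by
  simp only [region, mem_iUnion, mem_ofPred_eq] at h ⊢
  obtain ⟨v, hv, q, hq, rfl⟩ := h
  exact ⟨v.map g.dir, hv.map _, g.space q, g.mem_contactFace hq, g.imprint_map v q⟩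

theorem mem_interior_region {w : List Dir} {p : Plane} (h : p ∈ interior (region w)) :
    g.plane p ∈ interior (region (w.map g.dir)) := by
  have : g.plane '' interior (region w) ⊆ interior (region (w.map g.dir)) := by
    refine interior_maximal ?_ (g.plane.toHomeomorph.isOpenMap _ isOpen_interior)
    rintro _ ⟨p, hp, rfl⟩
    exact g.mem_region (interior_subset hp)
  exact this ⟨p, h, rfl⟩

theorem isLSPath_map {S T : Space} {w : List Dir} (h : IsLSPath S T w) :
    IsLSPath (g.space S) (g.space T) (w.map g.dir) := by
  refine ⟨g.isPartialUnfolding_map h.1, ?_⟩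
  have e := g.imprint_map [] S
  rw [List.map_nil] at e
  have hs := image_segment ℝ (g.plane.toLinearEquiv : Plane →ₗ[ℝ] Plane).toAffineMap
    (imprint [] S) (imprint w T)
  simp only [LinearMap.coe_toAffineMap, LinearEquiv.coe_coe,
    LinearIsometryEquiv.coe_toLinearEquiv] at hs
  rw [e, imprint_map, ← hs]
  rintro _ ⟨p, hp, rfl⟩
  exact g.mem_interior_region (h.2 hp)

theorem unfoldsTo_map {w : List Dir} {q : Space} {p : Plane} (h : UnfoldsTo w q p) :
    UnfoldsTo (w.map g.dir) (g.space q) (g.plane p) := by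
  obtain ⟨v, hv, hq, rfl⟩ := h
  exact ⟨v.map g.dir, hv.map _, g.mem_contactFace hq, g.imprint_map v q⟩

/-- The image of a path under a symmetry. -/
def path {S T : Space} (γ : Path S T) : Path (g.space S) (g.space T) :=
  γ.map g.space.continuous

theorem isSurfacePath_path {S T : Space} {γ : Path S T} (h : IsSurfacePath γ) :
    IsSurfacePath (g.path γ) := fun t => g.space_mem (h t)

theorem pathLength_path {S T : Space} (γ : Path S T) : pathLength (g.path γ) = pathLength γ := by
  simp only [pathLength, eVariationOn]
  congr! 3
  exact g.space.edist_map _ _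

/-- Since `g` is an involution, applying it to the unfolded line of the reflected path returns to
`γ`. -/
theorem unfoldsToLine_of_path {S T : Space} {γ : Path S T} {w : List Dir}
    (h : UnfoldsToLine (g.path γ) w) : UnfoldsToLine γ (w.map g.dir) := by
  obtain ⟨φ, h₁, h₂, h₃, h₄, h₅⟩ := h
  refine ⟨φ, h₁, h₂, h₃, h₄, fun t => ?_⟩
  have e := g.imprint_map [] (g.space S)
  have e' := g.imprint_map w (g.space T)
  rw [List.map_nil, g.space_space] at e
  rw [g.space_space] at e'
  have h := g.unfoldsTo_map (h₅ t)
  rw [show g.path γ t = g.space (γ t) from rfl, g.space_space] at h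
  rw [e, e']
  convert h using 1
  simp only [AffineMap.lineMap_apply_module, map_add, map_smul]

end CubeSymmetry

/-! ### Enumeration of the partial unfoldings -/

/-- A signed coordinate: the index and whether the sign is negative. -/
def coord (a : Fin 3 × Bool) (q : Space) : ℝ := if a.2 then -q a.1 else q a.1

/-- The signed coordinate of which `turn d` makes the signed coordinate `a`. -/
def pull : Dir → Fin 3 × Bool → Fin 3 × Bool
  | Dir.R, a => (![2, 1, 0] a.1, xor a.2 (a.1 == 2))
  | Dir.L, a => (![2, 1, 0] a.1, xor a.2 (a.1 == 0))
  | Dir.U, a => (![0, 2, 1] a.1, xor a.2 (a.1 == 2))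
  | Dir.D, a => (![0, 2, 1] a.1, xor a.2 (a.1 == 1))

/-- The signed coordinate that is the height after the rolls `w`. -/
def axis : List Dir → Fin 3 × Bool
  | [] => (2, false)
  | d :: w => pull d (axis w)

theorem coord_turn (d : Dir) (a : Fin 3 × Bool) (q : Space) :
    coord a (turn d q) = coord (pull d a) q := by
  obtain ⟨i, b⟩ := a
  cases d <;> fin_cases i <;> cases b <;> simp [coord, turn, pull]

theorem shift_two (d : Dir) : shift d 2 = 0 := by cases d <;> rfl

theorem rolled_two (w : List Dir) (q : Space) : rolled w q 2 = coord (axis w) q := by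
  induction w generalizing q with
  | nil => rfl
  | cons d w ih => simp [rolled, axis, shift_two, ih, coord_turn]

/-- The centre of the face on which the signed coordinate `a` is `-1`. -/
def center (a : Fin 3 × Bool) : Space :=
  WithLp.toLp 2 fun i => if i = a.1 then (if a.2 then 1 else -1) else 0

theorem coord_center {a b : Fin 3 × Bool} (h : coord b (center a) = -1) : b = a := by
  obtain ⟨i, s⟩ := a
  obtain ⟨j, t⟩ := b
  by_cases hij : j = i
  · subst hij
    cases s <;> cases t <;> first | rfl | norm_num [coord, center] at h
  · cases t <;> norm_num [coord, center, hij] at h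

theorem center_mem (a : Fin 3 × Bool) : center a ∈ cubeSurface ∧ coord a (center a) = -1 := by
  obtain ⟨i, s⟩ := a
  refine ⟨⟨fun j => ?_, i, ?_⟩, ?_⟩
  · by_cases hij : j = i <;> cases s <;> simp [center, hij]
  · cases s <;> simp [center]
  · cases s <;> simp [coord, center]

theorem contactFace_eq (w : List Dir) :
    contactFace w = {q | q ∈ cubeSurface ∧ coord (axis w) q = -1} := by
  ext q
  simp [contactFace, rolled_two]

/-- The centre of a face distinguishes it: only the signed coordinate of that face is -1 there. -/
theorem contactFace_eq_iff {v w : List Dir} : contactFace v = contactFace w ↔ axis v = axis w := by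
  constructor
  · intro h
    have : center (axis v) ∈ contactFace w := by
      rw [← h, contactFace_eq]
      exact center_mem _
    rw [contactFace_eq] at this
    exact (coord_center this.2).symm
  · intro h
    rw [contactFace_eq, contactFace_eq, h]

theorem contactFace_eq_targetFace_iff {w : List Dir} :
    contactFace w = targetFace ↔ axis w = (2, true) := by
  have h : targetFace = contactFace [Dir.R, Dir.R] := by
    ext q
    simp [targetFace, contactFace, rolled, turn, shift]
  rw [h, contactFace_eq_iff]
  rfl

theorem isPartialUnfolding_iff {w : List Dir} : IsPartialUnfolding w ↔
    (∀ i ≤ w.length, ∀ j ≤ w.length, axis (w.take i) = axis (w.take j) → i = j) ∧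
      axis w = (2, true) := by
  rw [IsPartialUnfolding, contactFace_eq_targetFace_iff]
  simp only [contactFace_eq_iff]
  refine and_congr_left fun _ => ⟨fun h i hi j hj e => ?_, fun h v₁ v₂ h₁ h₂ e => ?_⟩
  · have := congrArg List.length (h _ _ (List.take_prefix i w) (List.take_prefix j w) e)
    rwa [List.length_take_of_le hi, List.length_take_of_le hj] at this
  · rw [List.prefix_iff_eq_take] at h₁ h₂
    have l₁ : v₁.length ≤ w.length := by
      rw [h₁, List.length_take]
      exact min_le_right _ _
    have l₂ : v₂.length ≤ w.length := by
      rw [h₂, List.length_take]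
      exact min_le_right _ _
    have := h _ l₁ _ l₂ (by rwa [← h₁, ← h₂])
    rw [h₁, h₂, this]

/-- A sequence of `n` rolls meets `n + 1` distinct faces, and there are six. -/
theorem IsPartialUnfolding.length_le {w : List Dir} (h : IsPartialUnfolding w) :
    w.length ≤ 5 := by
  have hinj : Function.Injective fun i : Fin (w.length + 1) => axis (w.take i) := fun i j e =>
    Fin.ext ((isPartialUnfolding_iff.1 h).1 i (Nat.lt_succ_iff.1 i.2) j (Nat.lt_succ_iff.1 j.2) e)
  have := Fintype.card_le_of_injective _ hinj
  simp only [Fintype.card_fin, Fintype.card_prod, Fintype.card_bool] at this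
  omega

instance : DecidableEq Dir := fun a b => by
  cases a <;> cases b <;> first | exact isTrue rfl | exact isFalse nofun

instance : Fintype Dir := ⟨{Dir.R, Dir.L, Dir.U, Dir.D}, fun d => by cases d <;> decide⟩

/-- The condition of `isPartialUnfolding_iff`, in a form that can be evaluated. -/
def unfoldingTest (w : List Dir) : Bool :=
  decide (((List.range (w.length + 1)).map fun i => axis (w.take i)).Nodup) && axis w == (2, true)

theorem IsPartialUnfolding.unfoldingTest {w : List Dir} (h : IsPartialUnfolding w) :
    unfoldingTest w = true := by
  obtain ⟨h₁, h₂⟩ := isPartialUnfolding_iff.1 h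
  simp only [CubeUnfolding.unfoldingTest, h₂, beq_self_eq_true, Bool.and_true, decide_eq_true_eq]
  refine (List.nodup_map_iff_inj_on List.nodup_range).2 fun i hi j hj e => ?_
  rw [List.mem_range, Nat.lt_succ_iff] at hi hj
  exact h₁ i hi j hj e

open Dir in
/-- The partial unfoldings in which the segment is longer than in the unfolding grid. -/
def longUnfoldings : List (List Dir) :=
  [[R, U, U, R], [R, D, D, R], [L, U, U, L], [L, D, D, L],
   [U, R, R, U], [U, L, L, U], [D, R, R, D], [D, L, L, D],
   [R, U, U, U, R], [R, D, D, D, R], [L, U, U, U, L], [L, D, D, D, L],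
   [U, R, R, R, U], [U, L, L, L, U], [D, R, R, R, D], [D, L, L, L, D]]

open Dir in
/-- The unfolding grid as a list. -/
def gridList : List (List Dir) :=
  [[R, R], [R, U, R], [R, D, R], [L, L], [L, U, L], [L, D, L],
   [U, U], [U, R, U], [U, L, U], [D, D], [D, R, D], [D, L, D]]

theorem mem_gridList {w : List Dir} : w ∈ gridList ↔ w ∈ unfoldingGrid := by
  simp [gridList, unfoldingGrid]

/-- The bound on the length leaves finitely many sequences, which are all tested by evaluation. -/
theorem IsPartialUnfolding.mem {w : List Dir} (h : IsPartialUnfolding w) :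
    w ∈ unfoldingGrid ∨ w ∈ longUnfoldings := by
  rw [← mem_gridList, ← List.mem_append]
  have hl := h.length_le
  have ht := h.unfoldingTest
  clear h
  match w with
  | [] => revert ht; decide
  | [a] => revert a; decide +kernel
  | [a, b] => revert a b; decide +kernel
  | [a, b, c] => revert a b c; decide +kernel
  | [a, b, c, d] => revert a b c d; decide +kernel
  | [a, b, c, d, e] => revert a b c d e; decide +kernel
  | a :: b :: c :: d :: e :: f :: l =>
    simp only [List.length_cons] at hl
    omega

/-! ### Metric properties of rolling -/

theorem dist_turn (d : Dir) (p q : Space) : dist (turn d p) (turn d q) = dist p q := by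
  simp only [EuclideanSpace.dist_eq, Fin.sum_univ_three, Real.dist_eq, sq_abs]
  cases d <;> simp [turn] <;> ring_nf

theorem dist_rolled (w : List Dir) (p q : Space) : dist (rolled w p) (rolled w q) = dist p q := by
  induction w generalizing p q with
  | nil => rfl
  | cons d w ih => rw [rolled, rolled, dist_add_right, ih, dist_turn]

/-- Rolling is an isometry of space and is followed by an orthogonal projection. The points need not
lie on the contact face, which allows wandering paths to be projected. -/
theorem edist_imprint_le (w : List Dir) (p q : Space) :
    edist (imprint w p) (imprint w q) ≤ edist p q := by
  rw [edist_dist, edist_dist, ← dist_rolled w p q]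
  refine ENNReal.ofReal_le_ofReal ?_
  simp only [EuclideanSpace.dist_eq, Fin.sum_univ_three, Fin.sum_univ_two, Real.dist_eq, sq_abs]
  refine Real.sqrt_le_sqrt ?_
  simp only [imprint, PiLp.toLp_apply, Matrix.cons_val_zero, Matrix.cons_val_one]
  nlinarith [sq_nonneg (rolled w p 2 - rolled w q 2)]

theorem edist_imprint {w : List Dir} {p q : Space} (hp : p ∈ contactFace w)
    (hq : q ∈ contactFace w) : edist (imprint w p) (imprint w q) = edist p q := by
  rw [edist_dist, edist_dist, ← dist_rolled w p q]
  simp [EuclideanSpace.dist_eq, Fin.sum_univ_three, Real.dist_eq, imprint, hp.2, hq.2]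

@[fun_prop]
theorem continuous_imprint (w : List Dir) : Continuous (imprint w) :=
  (LipschitzWith.of_edist_le (edist_imprint_le w)).continuous

theorem eVariationOn_lineMap_le (a b : Plane) :
    eVariationOn (fun t : I => AffineMap.lineMap a b (t : ℝ)) univ ≤ edist a b := by
  have hL : LipschitzOnWith (nndist a b) (fun t : ℝ => AffineMap.lineMap a b t) univ :=
    (lipschitzWith_lineMap a b).lipschitzOnWith
  refine (hL.comp_eVariationOn_le (g := fun t : I => (t : ℝ)) (mapsTo_univ _ _)).trans ?_
  have hm : MonotoneOn (fun t : I => (t : ℝ)) univ := fun s _ t _ h => h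
  have := hm.eVariationOn_eq (mem_univ 0) (mem_univ 1)
  have hI : (univ : Set I) ∩ Icc 0 1 = univ := by
    ext x
    simp [unitInterval.le_one']
  rw [hI] at this
  calc (nndist a b : ℝ≥0∞) * eVariationOn (fun t : I => (t : ℝ)) univ
      ≤ (nndist a b : ℝ≥0∞) * 1 := by
        gcongr
        simp [this]
    _ = edist a b := by rw [mul_one, edist_nndist]

/-! ### Upper bound: folding segments back to the cube -/

/-- If a continuous map folds squares that cover the segment back to the cube, there is a surface
path that is at most as long as the segment. -/
theorem exists_path_of_fold {S T : Space} {w : List Dir} (F : Plane → Space) (hF : Continuous F)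
    (P : Finset (Set Plane))
    (hP : ∀ A ∈ P, IsClosed A ∧ ∃ v, ∀ p ∈ A, F p ∈ contactFace v ∧ imprint v (F p) = p)
    (hcov : ∀ p ∈ segment ℝ (imprint [] S) (imprint w T), ∃ A ∈ P, p ∈ A)
    (hS : F (imprint [] S) = S) (hT : F (imprint w T) = T) :
    ∃ γ : Path S T, IsSurfacePath γ ∧ pathLength γ ≤ lineLength S T w := by
  set a := imprint [] S
  set b := imprint w T
  let c : I → Plane := fun t => AffineMap.lineMap a b (t : ℝ)
  have hc : Continuous c := AffineMap.lineMap_continuous.comp continuous_subtype_val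
  have hcP : ∀ t, ∃ A ∈ P, c t ∈ A := fun t => hcov _ (by
    rw [segment_eq_image_lineMap]
    exact ⟨t, t.2, rfl⟩)
  refine ⟨⟨⟨fun t => F (c t), hF.comp hc⟩, ?_, ?_⟩, ?_, ?_⟩
  · simp [c, hS]
  · simp [c, hT]
  · intro t
    obtain ⟨A, hA, htA⟩ := hcP t
    obtain ⟨-, v, hv⟩ := hP A hA
    exact (hv _ htA).1.1
  · have hdom : DominatedOn (fun t => F (c t)) c 0 1 := by
      intro s t _ hst _
      refine edist_comp_le_eVariationOn hc P (fun A hA => (hP A hA).1) ?_ s t hst fun r _ => hcP r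
      intro A hA x hx y hy
      obtain ⟨-, v, hv⟩ := hP A hA
      rw [← edist_imprint (hv x hx).1 (hv y hy).1, (hv x hx).2, (hv y hy).2]
    refine hdom.eVariationOn_le.trans ((eVariationOn_lineMap_le a b).trans ?_)
    rw [lineLength, edist_dist]

/-- A closed box in the plane. -/
def box (a b c d : ℝ) : Set Plane := {p | a ≤ p 0 ∧ p 0 ≤ b ∧ c ≤ p 1 ∧ p 1 ≤ d}

theorem isClosed_box (a b c d : ℝ) : IsClosed (box a b c d) := by
  change IsClosed ({p : Plane | a ≤ p 0} ∩ ({p | p 0 ≤ b} ∩ ({p | c ≤ p 1} ∩ {p | p 1 ≤ d})))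
  refine IsClosed.inter (isClosed_le ?_ ?_) (IsClosed.inter (isClosed_le ?_ ?_)
    (IsClosed.inter (isClosed_le ?_ ?_) (isClosed_le ?_ ?_))) <;> fun_prop

/-- An open box in the plane. -/
def openBox (a b c d : ℝ) : Set Plane := {p | a < p 0 ∧ p 0 < b ∧ c < p 1 ∧ p 1 < d}

theorem isOpen_openBox (a b c d : ℝ) : IsOpen (openBox a b c d) := by
  change IsOpen ({p : Plane | a < p 0} ∩ ({p | p 0 < b} ∩ ({p | c < p 1} ∩ {p | p 1 < d})))
  refine IsOpen.inter (isOpen_lt ?_ ?_) (IsOpen.inter (isOpen_lt ?_ ?_)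
    (IsOpen.inter (isOpen_lt ?_ ?_) (isOpen_lt ?_ ?_))) <;> fun_prop

/-- Folding the squares of `[R, R]` back to the cube. -/
def foldRR (p : Plane) : Space :=
  !₂[min (p 0) 1 - max (p 0 - 3) 0, p 1, max (-1) (min 1 (p 0 - 2))]

/-- Folding the squares of `[R, U, R]` back to the cube. -/
def foldRUR (p : Plane) : Space :=
  !₂[min (p 0) 1 - max (p 1 - 1) 0, min (p 1) 1 - max (p 0 - 3) 0, max (-1) (min 1 (p 0 - 2))]

@[fun_prop]
theorem continuous_foldRR : Continuous foldRR := by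
  unfold foldRR
  fun_prop

@[fun_prop]
theorem continuous_foldRUR : Continuous foldRUR := by
  unfold foldRUR
  fun_prop

open Dir

theorem imprint_nil (q : Space) : imprint [] q = !₂[q 0, q 1] := rfl

theorem imprint_R (q : Space) : imprint [R] q = !₂[q 2 + 2, q 1] :=
  plane_ext rfl (add_zero _)

theorem imprint_RR (q : Space) : imprint [R, R] q = !₂[-q 0 + 4, q 1] := by
  apply plane_ext <;> (simp [imprint, rolled, turn, shift]; try ring)

theorem imprint_RU (q : Space) : imprint [R, U] q = !₂[q 2 + 2, -q 0 + 2] := by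
  apply plane_ext <;> simp [imprint, rolled, turn, shift]

theorem imprint_RUR (q : Space) : imprint [R, U, R] q = !₂[-q 1 + 4, -q 0 + 2] := by
  apply plane_ext <;> (simp [imprint, rolled, turn, shift]; try ring)

theorem imprint_UU (q : Space) : imprint [U, U] q = !₂[q 0, -q 1 + 4] := by
  apply plane_ext <;> (simp [imprint, rolled, turn, shift]; try ring)

theorem imprint_RUUR (q : Space) : imprint [R, U, U, R] q = !₂[q 0 + 4, -q 1 + 4] := by
  apply plane_ext <;> (simp [imprint, rolled, turn, shift]; ring)

theorem mem_contactFace_nil {q : Space} :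
    q ∈ contactFace [] ↔ |q 0| ≤ 1 ∧ |q 1| ≤ 1 ∧ q 2 = -1 := by
  rw [contactFace, mem_ofPred_eq, mem_cubeSurface]
  change _ ∧ q 2 = -1 ↔ _
  constructor
  · rintro ⟨h, h'⟩
    exact ⟨h.1.1, h.1.2.1, h'⟩
  · rintro ⟨h, h', h''⟩
    simp [h, h', h'']

theorem mem_contactFace_R {q : Space} :
    q ∈ contactFace [R] ↔ q 0 = 1 ∧ |q 1| ≤ 1 ∧ |q 2| ≤ 1 := by
  rw [contactFace, mem_ofPred_eq, mem_cubeSurface]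
  have : rolled [R] q 2 = - q 0 := by simp [rolled, turn, shift]
  rw [this, neg_inj]
  constructor
  · rintro ⟨h, h'⟩
    exact ⟨h', h.1.2.1, h.1.2.2⟩
  · rintro ⟨h, h', h''⟩
    simp [h, h', h'']

theorem mem_contactFace_RU {q : Space} :
    q ∈ contactFace [R, U] ↔ q 1 = 1 ∧ |q 0| ≤ 1 ∧ |q 2| ≤ 1 := by
  rw [contactFace, mem_ofPred_eq, mem_cubeSurface]
  have : rolled [R, U] q 2 = - q 1 := by simp [rolled, turn, shift]
  rw [this, neg_inj]
  constructor
  · rintro ⟨h, h'⟩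
    exact ⟨h', h.1.1, h.1.2.2⟩
  · rintro ⟨h, h', h''⟩
    simp [h, h', h'']

theorem contactFace_RUR : contactFace [R, U, R] = contactFace [R, R] :=
  contactFace_eq_iff.2 (by decide)

theorem mem_contactFace_RR {q : Space} :
    q ∈ contactFace [R, R] ↔ |q 0| ≤ 1 ∧ |q 1| ≤ 1 ∧ q 2 = 1 := by
  rw [contactFace, mem_ofPred_eq, mem_cubeSurface]
  have : rolled [R, R] q 2 = - q 2 := by simp [rolled, turn, shift]
  rw [this, neg_inj]
  constructor
  · rintro ⟨h, h'⟩
    exact ⟨h.1.1, h.1.2.1, h'⟩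
  · rintro ⟨h, h', h''⟩
    simp [h, h', h'']

theorem foldRR_nil {p : Plane} (hp : p ∈ box (-1) 1 (-1) 1) :
    foldRR p ∈ contactFace [] ∧ imprint [] (foldRR p) = p := by
  obtain ⟨h₁, h₂, h₃, h₄⟩ := hp
  have e : foldRR p = !₂[p 0, p 1, -1] := by
    rw [foldRR, min_eq_left h₂, max_eq_right (by linarith), sub_zero,
      max_eq_left ((min_le_right _ _).trans (by linarith))]
  rw [e, mem_contactFace_nil, imprint_nil]
  exact ⟨⟨abs_le.2 ⟨h₁, h₂⟩, abs_le.2 ⟨h₃, h₄⟩, rfl⟩, plane_ext rfl rfl⟩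

theorem foldRR_R {p : Plane} (hp : p ∈ box 1 3 (-1) 1) :
    foldRR p ∈ contactFace [R] ∧ imprint [R] (foldRR p) = p := by
  obtain ⟨h₁, h₂, h₃, h₄⟩ := hp
  have e : foldRR p = !₂[1, p 1, p 0 - 2] := by
    rw [foldRR, min_eq_right h₁, max_eq_right (by linarith), sub_zero,
      min_eq_right (by linarith), max_eq_right (by linarith)]
  rw [e, mem_contactFace_R, imprint_R]
  exact ⟨⟨rfl, abs_le.2 ⟨h₃, h₄⟩, abs_le.2 ⟨by simp; linarith, by simp; linarith⟩⟩,
    plane_ext (sub_add_cancel _ _) rfl⟩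

theorem foldRR_RR {p : Plane} (hp : p ∈ box 3 5 (-1) 1) :
    foldRR p ∈ contactFace [R, R] ∧ imprint [R, R] (foldRR p) = p := by
  obtain ⟨h₁, h₂, h₃, h₄⟩ := hp
  have e : foldRR p = !₂[4 - p 0, p 1, 1] := by
    rw [foldRR, min_eq_right (by linarith), max_eq_left (by linarith),
      min_eq_left (by linarith), max_eq_right (by linarith)]
    exact space_ext (by simp; ring) rfl rfl
  rw [e, mem_contactFace_RR, imprint_RR]
  exact ⟨⟨abs_le.2 ⟨by simp; linarith, by simp; linarith⟩, abs_le.2 ⟨h₃, h₄⟩, rfl⟩,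
    plane_ext (by simp) rfl⟩

theorem foldRUR_nil {p : Plane} (hp : p ∈ box (-1) 1 (-1) 1) :
    foldRUR p ∈ contactFace [] ∧ imprint [] (foldRUR p) = p := by
  obtain ⟨h₁, h₂, h₃, h₄⟩ := hp
  have e : foldRUR p = !₂[p 0, p 1, -1] := by
    rw [foldRUR, min_eq_left h₂, max_eq_right (by linarith), max_eq_right (by linarith), sub_zero,
      min_eq_left h₄, sub_zero, max_eq_left ((min_le_right _ _).trans (by linarith))]
  rw [e, mem_contactFace_nil, imprint_nil]
  exact ⟨⟨abs_le.2 ⟨h₁, h₂⟩, abs_le.2 ⟨h₃, h₄⟩, rfl⟩, plane_ext rfl rfl⟩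

theorem foldRUR_R {p : Plane} (hp : p ∈ box 1 3 (-1) 1) :
    foldRUR p ∈ contactFace [R] ∧ imprint [R] (foldRUR p) = p := by
  obtain ⟨h₁, h₂, h₃, h₄⟩ := hp
  have e : foldRUR p = !₂[1, p 1, p 0 - 2] := by
    rw [foldRUR, min_eq_right h₁, max_eq_right (by linarith), max_eq_right (by linarith), sub_zero,
      min_eq_left h₄, sub_zero, min_eq_right (by linarith), max_eq_right (by linarith)]
  rw [e, mem_contactFace_R, imprint_R]
  exact ⟨⟨rfl, abs_le.2 ⟨h₃, h₄⟩, abs_le.2 ⟨by simp; linarith, by simp; linarith⟩⟩,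
    plane_ext (sub_add_cancel _ _) rfl⟩

theorem foldRUR_RU {p : Plane} (hp : p ∈ box 1 3 1 3) :
    foldRUR p ∈ contactFace [R, U] ∧ imprint [R, U] (foldRUR p) = p := by
  obtain ⟨h₁, h₂, h₃, h₄⟩ := hp
  have e : foldRUR p = !₂[2 - p 1, 1, p 0 - 2] := by
    rw [foldRUR, min_eq_right h₁, max_eq_left (by linarith), max_eq_right (by linarith),
      min_eq_right h₃, sub_zero, min_eq_right (by linarith), max_eq_right (by linarith)]
    exact space_ext (by simp; ring) rfl rfl
  rw [e, mem_contactFace_RU, imprint_RU]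
  exact ⟨⟨rfl, abs_le.2 ⟨by simp; linarith, by simp; linarith⟩,
    abs_le.2 ⟨by simp; linarith, by simp; linarith⟩⟩,
    plane_ext (sub_add_cancel _ _) (by simp)⟩

theorem foldRUR_RUR {p : Plane} (hp : p ∈ box 3 5 1 3) :
    foldRUR p ∈ contactFace [R, U, R] ∧ imprint [R, U, R] (foldRUR p) = p := by
  obtain ⟨h₁, h₂, h₃, h₄⟩ := hp
  have e : foldRUR p = !₂[2 - p 1, 4 - p 0, 1] := by
    rw [foldRUR, min_eq_right (by linarith), max_eq_left (by linarith), max_eq_left (by linarith),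
      min_eq_right h₃, min_eq_left (by linarith), max_eq_right (by linarith)]
    exact space_ext (by simp; ring) (by simp; ring) rfl
  rw [e, contactFace_RUR, mem_contactFace_RR, imprint_RUR]
  exact ⟨⟨abs_le.2 ⟨by simp; linarith, by simp; linarith⟩,
    abs_le.2 ⟨by simp; linarith, by simp; linarith⟩, rfl⟩,
    plane_ext (by simp) (by simp)⟩

theorem lineLength_le_iff {S T : Space} {v w : List Dir} :
    lineLength S T v ≤ lineLength S T w ↔
      (S 0 - imprint v T 0) ^ 2 + (S 1 - imprint v T 1) ^ 2 ≤
        (S 0 - imprint w T 0) ^ 2 + (S 1 - imprint w T 1) ^ 2 := by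
  rw [lineLength, lineLength, ENNReal.ofReal_le_ofReal_iff dist_nonneg]
  simp only [EuclideanSpace.dist_eq, Fin.sum_univ_two, Real.dist_eq, sq_abs, imprint_nil]
  exact Real.sqrt_le_sqrt_iff (by positivity)

theorem isPartialUnfolding_RR : IsPartialUnfolding [R, R] :=
  isPartialUnfolding_iff.2 (by decide)

theorem isPartialUnfolding_RUR : IsPartialUnfolding [R, U, R] :=
  isPartialUnfolding_iff.2 (by decide)

theorem mem_region {v w : List Dir} (hv : v <+: w) {q : Space} {p : Plane}
    (h : q ∈ contactFace v ∧ imprint v q = p) : p ∈ region w :=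
  mem_biUnion (show v ∈ {v | v <+: w} from hv) ⟨q, h⟩

theorem openBox_subset_RR : openBox (-1) 5 (-1) 1 ⊆ region [R, R] := by
  rintro p ⟨h₁, h₂, h₃, h₄⟩
  rcases le_total (p 0) 1 with h | h
  · exact mem_region (by decide) (foldRR_nil ⟨h₁.le, h, h₃.le, h₄.le⟩)
  rcases le_total (p 0) 3 with h' | h'
  · exact mem_region (by decide) (foldRR_R ⟨h, h', h₃.le, h₄.le⟩)
  · exact mem_region (by decide) (foldRR_RR ⟨h', h₂.le, h₃.le, h₄.le⟩)

/-- The region of RUR is a staircase of four squares. Three open rectangles of two consecutive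
squares each overlap enough to contain a segment that avoids the reflex corners, including where it
crosses common edges. -/
theorem openBox_subset_RUR₁ : openBox (-1) 3 (-1) 1 ⊆ region [R, U, R] := by
  rintro p ⟨h₁, h₂, h₃, h₄⟩
  rcases le_total (p 0) 1 with h | h
  · exact mem_region (by decide) (foldRUR_nil ⟨h₁.le, h, h₃.le, h₄.le⟩)
  · exact mem_region (by decide) (foldRUR_R ⟨h, h₂.le, h₃.le, h₄.le⟩)

theorem openBox_subset_RUR₂ : openBox 1 3 (-1) 3 ⊆ region [R, U, R] := by
  rintro p ⟨h₁, h₂, h₃, h₄⟩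
  rcases le_total (p 1) 1 with h | h
  · exact mem_region (by decide) (foldRUR_R ⟨h₁.le, h₂.le, h₃.le, h⟩)
  · exact mem_region (by decide) (foldRUR_RU ⟨h₁.le, h₂.le, h, h₄.le⟩)

theorem openBox_subset_RUR₃ : openBox 1 5 1 3 ⊆ region [R, U, R] := by
  rintro p ⟨h₁, h₂, h₃, h₄⟩
  rcases le_total (p 0) 3 with h | h
  · exact mem_region (by decide) (foldRUR_RU ⟨h₁.le, h, h₃.le, h₄.le⟩)
  · exact mem_region (by decide) (foldRUR_RUR ⟨h, h₂.le, h₃.le, h₄.le⟩)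

/-- The segment is an LS-path, and it folds to a surface path that is not longer. -/
def IsRealized (S T : Space) (w : List Dir) : Prop :=
  IsLSPath S T w ∧ ∃ γ : Path S T, IsSurfacePath γ ∧ pathLength γ ≤ lineLength S T w

theorem exists_of_mem_segment {a b p : Plane} (hp : p ∈ segment ℝ a b) :
    ∃ r : ℝ, 0 ≤ r ∧ r ≤ 1 ∧ p 0 = (1 - r) * a 0 + r * b 0 ∧ p 1 = (1 - r) * a 1 + r * b 1 := by
  rw [segment_eq_image] at hp
  obtain ⟨r, ⟨h₀, h₁⟩, rfl⟩ := hp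
  exact ⟨r, h₀, h₁, rfl, rfl⟩

theorem convex_lt {l a b r : ℝ} (hr : 0 ≤ r) (hr' : r ≤ 1) (ha : l < a) (hb : l < b) :
    l < (1 - r) * a + r * b := by
  rcases hr.eq_or_lt with rfl | h
  · linarith
  · nlinarith [mul_pos h (sub_pos.2 hb), mul_nonneg (sub_nonneg.2 hr') (sub_pos.2 ha).le]

theorem convex_gt {l a b r : ℝ} (hr : 0 ≤ r) (hr' : r ≤ 1) (ha : a < l) (hb : b < l) :
    (1 - r) * a + r * b < l := by
  have := convex_lt hr hr' (neg_lt_neg ha) (neg_lt_neg hb)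
  linarith

section

variable {S T : Space} (hS : S ∈ openSourceFace) (hT : T ∈ openTargetFace)
include hS hT

theorem segment_RR_bounds {p : Plane} (hp : p ∈ segment ℝ (imprint [] S) (imprint [R, R] T)) :
    p ∈ openBox (-1) 5 (-1) 1 := by
  obtain ⟨-, h₀, h₁⟩ := hS
  obtain ⟨-, k₀, k₁⟩ := hT
  rw [abs_lt] at h₀ h₁ k₀ k₁
  obtain ⟨r, hr, hr', e₀, e₁⟩ := exists_of_mem_segment hp
  rw [imprint_nil, imprint_RR] at e₀ e₁
  simp only [Matrix.cons_val_zero, Matrix.cons_val_one] at e₀ e₁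
  refine ⟨?_, ?_, ?_, ?_⟩
  · exact (convex_lt hr hr' (by linarith) (by linarith)).trans_eq e₀.symm
  · exact e₀.trans_lt (convex_gt hr hr' (by linarith) (by linarith))
  · exact (convex_lt hr hr' (by linarith) (by linarith)).trans_eq e₁.symm
  · exact e₁.trans_lt (convex_gt hr hr' (by linarith) (by linarith))

theorem segment_RUR_bounds {p : Plane}
    (hp : p ∈ segment ℝ (imprint [] S) (imprint [R, U, R] T)) :
    p ∈ openBox (-1) 5 (-1) 3 ∧
      (p 0 - S 0) * (2 - T 0 - S 1) = (p 1 - S 1) * (4 - T 1 - S 0) := by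
  obtain ⟨-, h₀, h₁⟩ := hS
  obtain ⟨-, k₀, k₁⟩ := hT
  rw [abs_lt] at h₀ h₁ k₀ k₁
  obtain ⟨r, hr, hr', e₀, e₁⟩ := exists_of_mem_segment hp
  rw [imprint_nil, imprint_RUR] at e₀ e₁
  simp only [Matrix.cons_val_zero, Matrix.cons_val_one] at e₀ e₁
  refine ⟨⟨?_, ?_, ?_, ?_⟩, ?_⟩
  · exact (convex_lt hr hr' (by linarith) (by linarith)).trans_eq e₀.symm
  · exact e₀.trans_lt (convex_gt hr hr' (by linarith) (by linarith))
  · exact (convex_lt hr hr' (by linarith) (by linarith)).trans_eq e₁.symm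
  · exact e₁.trans_lt (convex_gt hr hr' (by linarith) (by linarith))
  · rw [e₀, e₁]
    ring

theorem isRealized_RR : IsRealized S T [R, R] := by
  refine ⟨⟨isPartialUnfolding_RR, fun p hp => ?_⟩, ?_⟩
  · exact interior_maximal openBox_subset_RR (isOpen_openBox _ _ _ _) (segment_RR_bounds hS hT hp)
  classical
  refine exists_path_of_fold foldRR continuous_foldRR
    {box (-1) 1 (-1) 1, box 1 3 (-1) 1, box 3 5 (-1) 1} ?_ ?_ ?_ ?_
  · intro A hA
    simp only [Finset.mem_insert, Finset.mem_singleton] at hA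
    rcases hA with rfl | rfl | rfl
    · exact ⟨isClosed_box _ _ _ _, _, fun p => foldRR_nil⟩
    · exact ⟨isClosed_box _ _ _ _, _, fun p => foldRR_R⟩
    · exact ⟨isClosed_box _ _ _ _, _, fun p => foldRR_RR⟩
  · intro p hp
    obtain ⟨h₁, h₂, h₃, h₄⟩ := segment_RR_bounds hS hT hp
    rcases le_total (p 0) 1 with h | h
    · exact ⟨box (-1) 1 (-1) 1, by simp, h₁.le, h, h₃.le, h₄.le⟩
    rcases le_total (p 0) 3 with h' | h'
    · exact ⟨box 1 3 (-1) 1, by simp, h, h', h₃.le, h₄.le⟩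
    · exact ⟨box 3 5 (-1) 1, by simp, h', h₂.le, h₃.le, h₄.le⟩
  · obtain ⟨h₂, h₀, h₁⟩ := hS
    rw [abs_lt] at h₀ h₁
    simp only [foldRR, imprint_nil, PiLp.toLp_apply, Matrix.cons_val_zero, Matrix.cons_val_one]
    rw [min_eq_left (by linarith), max_eq_right (by linarith), sub_zero,
      max_eq_left ((min_le_right _ _).trans (by linarith))]
    exact space_ext rfl rfl h₂.symm
  · obtain ⟨h₂, h₀, h₁⟩ := hT
    rw [abs_lt] at h₀ h₁
    simp only [foldRR, imprint_RR, PiLp.toLp_apply, Matrix.cons_val_zero, Matrix.cons_val_one]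
    rw [min_eq_right (by linarith), max_eq_left (by linarith), min_eq_left (by linarith),
      max_eq_right (by linarith)]
    exact space_ext (by simp; ring) rfl h₂.symm

/-- The staircase has reflex corners (1,1) and (3,1). The segment must cross the line `y = 1`
strictly between them; being no longer than the segments of UU and RR forces this. -/
theorem isRealized_RUR (hUU : lineLength S T [R, U, R] ≤ lineLength S T [U, U])
    (hRR : lineLength S T [R, U, R] ≤ lineLength S T [R, R]) : IsRealized S T [R, U, R] := by
  have key : ∀ p ∈ segment ℝ (imprint [] S) (imprint [R, U, R] T),
      p ∈ openBox (-1) 5 (-1) 3 ∧ (p 1 ≤ 1 → p 0 < 3) ∧ (1 ≤ p 1 → 1 < p 0) := by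
    intro p hp
    obtain ⟨hb, hp⟩ := segment_RUR_bounds hS hT hp
    refine ⟨hb, ?_⟩
    obtain ⟨-, h₀, h₁⟩ := hS
    obtain ⟨-, k₀, k₁⟩ := hT
    rw [abs_lt] at h₀ h₁ k₀ k₁
    rw [lineLength_le_iff] at hUU hRR
    simp only [imprint_UU, imprint_RR, imprint_RUR, PiLp.toLp_apply, Matrix.cons_val_zero,
      Matrix.cons_val_one] at hUU hRR
    -- `c₁` says that the segment passes (1,1) on the right. Expanded, `hUU` reads `(1 - S 0) * (3 -
    -- T 1) + (1 - S 1) * (1 - T 0) + (1 - S 0) * (1 - T 0) ≤ (1 - S 1) * (3 - T 1)`, where the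
    -- first two terms are positive. In the same way `hRR` gives `c₂`, for the corner (3,1).
    have c₁ : (1 - S 0) * (1 - T 0) < (1 - S 1) * (3 - T 1) := by
      nlinarith [mul_pos (sub_pos.2 h₀.2) (show 0 < 3 - T 1 by linarith),
        mul_pos (sub_pos.2 h₁.2) (sub_pos.2 k₀.2)]
    have c₂ : (1 - S 1) * (1 - T 1) < (3 - S 0) * (1 - T 0) := by
      nlinarith [mul_pos (sub_pos.2 k₁.2) (show 0 < 3 - S 0 by linarith),
        mul_pos (sub_pos.2 h₁.2) (sub_pos.2 k₀.2)]
    constructor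
    · intro h
      by_contra! h'
      nlinarith [mul_nonneg (sub_nonneg.2 h') (show 0 ≤ 2 - T 0 - S 1 by linarith),
        mul_nonneg (sub_nonneg.2 h) (show 0 ≤ 4 - T 1 - S 0 by linarith)]
    · intro h
      by_contra! h'
      nlinarith [mul_nonneg (sub_nonneg.2 h') (show 0 ≤ 2 - T 0 - S 1 by linarith),
        mul_nonneg (sub_nonneg.2 h) (show 0 ≤ 4 - T 1 - S 0 by linarith)]
  refine ⟨⟨isPartialUnfolding_RUR, fun p hp => ?_⟩, ?_⟩
  · obtain ⟨⟨h₁, h₂, h₃, h₄⟩, h₅, h₆⟩ := key p hp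
    rcases lt_trichotomy (p 1) 1 with h | h | h
    · exact interior_maximal openBox_subset_RUR₁ (isOpen_openBox _ _ _ _) ⟨h₁, h₅ h.le, h₃, h⟩
    · exact interior_maximal openBox_subset_RUR₂ (isOpen_openBox _ _ _ _)
        ⟨h₆ h.ge, h₅ h.le, h₃, h₄⟩
    · exact interior_maximal openBox_subset_RUR₃ (isOpen_openBox _ _ _ _) ⟨h₆ h.le, h₂, h, h₄⟩
  classical
  refine exists_path_of_fold foldRUR continuous_foldRUR
    {box (-1) 1 (-1) 1, box 1 3 (-1) 1, box 1 3 1 3, box 3 5 1 3} ?_ ?_ ?_ ?_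
  · intro A hA
    simp only [Finset.mem_insert, Finset.mem_singleton] at hA
    rcases hA with rfl | rfl | rfl | rfl
    · exact ⟨isClosed_box _ _ _ _, _, fun p => foldRUR_nil⟩
    · exact ⟨isClosed_box _ _ _ _, _, fun p => foldRUR_R⟩
    · exact ⟨isClosed_box _ _ _ _, _, fun p => foldRUR_RU⟩
    · exact ⟨isClosed_box _ _ _ _, _, fun p => foldRUR_RUR⟩
  · intro p hp
    obtain ⟨⟨h₁, h₂, h₃, h₄⟩, h₅, h₆⟩ := key p hp
    rcases le_total (p 1) 1 with h | h
    · rcases le_total (p 0) 1 with h' | h'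
      · exact ⟨box (-1) 1 (-1) 1, by simp, h₁.le, h', h₃.le, h⟩
      · exact ⟨box 1 3 (-1) 1, by simp, h', (h₅ h).le, h₃.le, h⟩
    · rcases le_total (p 0) 3 with h' | h'
      · exact ⟨box 1 3 1 3, by simp, (h₆ h).le, h', h, h₄.le⟩
      · exact ⟨box 3 5 1 3, by simp, h', h₂.le, h, h₄.le⟩
  · obtain ⟨h₂, h₀, h₁⟩ := hS
    rw [abs_lt] at h₀ h₁
    simp only [foldRUR, imprint_nil, PiLp.toLp_apply, Matrix.cons_val_zero, Matrix.cons_val_one]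
    rw [min_eq_left (by linarith), max_eq_right (by linarith), max_eq_right (by linarith),
      min_eq_left (by linarith), sub_zero, sub_zero,
      max_eq_left ((min_le_right _ _).trans (by linarith))]
    exact space_ext rfl rfl h₂.symm
  · obtain ⟨h₂, h₀, h₁⟩ := hT
    rw [abs_lt] at h₀ h₁
    simp only [foldRUR, imprint_RUR, PiLp.toLp_apply, Matrix.cons_val_zero, Matrix.cons_val_one]
    rw [min_eq_right (by linarith), max_eq_left (by linarith), max_eq_left (by linarith),
      min_eq_right (by linarith), min_eq_left (by linarith), max_eq_right (by linarith)]
    exact space_ext (by simp; ring) (by simp; ring) h₂.symm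

end

/-- If the segment is shortest in the unfolding grid, then it is realized. -/
def RealizedIfShortest (w : List Dir) : Prop :=
  ∀ S T, S ∈ openSourceFace → T ∈ openTargetFace →
    (∀ v ∈ unfoldingGrid, lineLength S T w ≤ lineLength S T v) → IsRealized S T w

theorem RealizedIfShortest.map {w : List Dir} (h : RealizedIfShortest w) (g : CubeSymmetry) :
    RealizedIfShortest (w.map g.dir) := by
  intro S T hS hT hw
  obtain ⟨h₁, γ, h₂, h₃⟩ := h (g.space S) (g.space T) (g.source hS) (g.target hT) (fun v hv => by
    have := hw _ (g.grid hv)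
    rwa [← g.lineLength_map, ← g.lineLength_map _ _ (v.map g.dir), g.map_map, g.map_map] at this)
  have h₄ := g.isLSPath_map h₁
  have h₅ := g.isSurfacePath_path h₂
  have h₆ := g.pathLength_path γ
  have h₇ := g.lineLength_map S T (w.map g.dir)
  rw [g.map_map] at h₇
  rw [← h₆, h₇] at h₃
  -- The ends of `g.path γ` are `S` and `T` only up to a propositional equality, so the path is
  -- generalized before its type is rewritten.
  generalize g.path γ = γ' at h₃ h₅
  revert γ'
  rw [g.space_space, g.space_space] at *
  exact fun γ' h₃ h₅ => ⟨h₄, γ', h₅, h₃⟩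

theorem realizedIfShortest {w : List Dir} (hw : w ∈ unfoldingGrid) : RealizedIfShortest w := by
  have hRR : RealizedIfShortest [R, R] := fun S T hS hT _ => isRealized_RR hS hT
  have hRUR : RealizedIfShortest [R, U, R] := fun S T hS hT h =>
    isRealized_RUR hS hT (h _ (by simp [unfoldingGrid])) (h _ (by simp [unfoldingGrid]))
  have hLL := hRR.map .flipX
  have hUU := hRR.map .swap
  have hDD := hUU.map .flipY
  have hRDR := hRUR.map .flipY
  have hLUL := hRUR.map .flipX
  have hLDL := hRDR.map .flipX
  have hURU := hRUR.map .swap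
  have hULU := hURU.map .flipX
  have hDRD := hURU.map .flipY
  have hDLD := hULU.map .flipY
  simp only [unfoldingGrid, mem_insert_iff, mem_singleton_iff] at hw
  rcases hw with rfl | rfl | rfl | rfl | rfl | rfl | rfl | rfl | rfl | rfl | rfl | rfl <;>
    assumption

/-! ### Partial unfoldings outside the grid -/

/-- The segment is at least as long as some segment of the unfolding grid. -/
def BoundedByGrid (w : List Dir) : Prop :=
  ∀ S T, S ∈ openSourceFace → T ∈ openTargetFace →
    ∃ v ∈ unfoldingGrid, lineLength S T v ≤ lineLength S T w

theorem BoundedByGrid.map {w : List Dir} (h : BoundedByGrid w) (g : CubeSymmetry) :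
    BoundedByGrid (w.map g.dir) := by
  intro S T hS hT
  obtain ⟨v, hv, hle⟩ := h (g.space S) (g.space T) (g.source hS) (g.target hT)
  refine ⟨v.map g.dir, g.grid hv, ?_⟩
  rwa [← g.lineLength_map, g.map_map, ← g.lineLength_map S, g.map_map]

/-- The two images of `T` differ by 4 in the direction `x` only, while `|S 0 - T 0| < 2`. Strictness
is needed to exclude paths of this type from the shortest ones. -/
theorem lineLength_UU_lt {S T : Space} (hS : S ∈ openSourceFace) (hT : T ∈ openTargetFace) :
    lineLength S T [U, U] < lineLength S T [R, U, U, R] := by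
  obtain ⟨-, h₀, h₁⟩ := hS
  obtain ⟨-, k₀, k₁⟩ := hT
  rw [abs_lt] at h₀ h₁ k₀ k₁
  rw [← not_le, lineLength_le_iff]
  simp [imprint, rolled, turn, shift]
  nlinarith

theorem boundedByGrid_of_long : ∀ w ∈ longUnfoldings, BoundedByGrid w := by
  have h₁ : BoundedByGrid [R, U, U, R] := fun S T hS hT =>
    ⟨[U, U], by simp [unfoldingGrid], (lineLength_UU_lt hS hT).le⟩
  have h₂ : BoundedByGrid [R, U, U, U, R] := by
    rintro S T ⟨-, h₀, h₁⟩ ⟨-, k₀, k₁⟩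
    -- UUU turns the cube as D does, so the two images of `T` differ by the translation by 8 in the
    -- direction `y`. The differences of the second coordinates are `S 1 - T 0 + 2`, less than 4 in
    -- absolute value, and that number minus 8.
    refine ⟨[R, D, R], by simp [unfoldingGrid], ?_⟩
    rw [abs_lt] at h₀ h₁ k₀ k₁
    rw [lineLength_le_iff]
    simp [imprint, rolled, turn, shift]
    nlinarith
  have key : ∀ {d e : List Dir}, BoundedByGrid d → BoundedByGrid e → ∀ g : CubeSymmetry,
      BoundedByGrid (d.map g.dir) ∧ BoundedByGrid (e.map g.dir) :=
    fun h h' g => ⟨h.map g, h'.map g⟩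
  obtain ⟨a₁, a₂⟩ := key h₁ h₂ .flipY
  obtain ⟨b₁, b₂⟩ := key h₁ h₂ .flipX
  obtain ⟨c₁, c₂⟩ := key a₁ a₂ .flipX
  obtain ⟨d₁, d₂⟩ := key h₁ h₂ .swap
  obtain ⟨e₁, e₂⟩ := key a₁ a₂ .swap
  obtain ⟨f₁, f₂⟩ := key b₁ b₂ .swap
  obtain ⟨i₁, i₂⟩ := key c₁ c₂ .swap
  simp only [longUnfoldings, List.forall_mem_cons]
  exact ⟨h₁, a₁, b₁, c₁, d₁, e₁, f₁, i₁, h₂, a₂, b₂, c₂, d₂, e₂, f₂, i₂, by simp⟩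

theorem IsPartialUnfolding.boundedByGrid {w : List Dir} (h : IsPartialUnfolding w) :
    BoundedByGrid w := by
  rcases h.mem with hw | hw
  · exact fun S T _ _ => ⟨w, hw, le_rfl⟩
  · exact boundedByGrid_of_long w hw

/-! ### Lower bound: developing surface paths -/

/-- A development of the four lateral faces in which faces opposite to each other are folded onto
each other. -/
def slant (c ε : ℝ) (q : Space) : Plane := !₂[q 2 + 2, c + ε * q 1 - q 0]

@[fun_prop]
theorem continuous_slant (c ε : ℝ) : Continuous (slant c ε) := by
  unfold slant
  fun_prop

/-- Where `x` or `y` is constant, `slant` keeps `z` and the other coordinate up to signs and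
translations. On all of space it is not 1-Lipschitz, so it is applied face by face. -/
theorem edist_slant_le {c ε : ℝ} (hε : ε ^ 2 = 1) {p q : Space} (h : p 0 = q 0 ∨ p 1 = q 1) :
    edist (slant c ε p) (slant c ε q) ≤ edist p q := by
  rw [edist_dist, edist_dist]
  refine ENNReal.ofReal_le_ofReal ?_
  simp only [EuclideanSpace.dist_eq, Fin.sum_univ_three, Fin.sum_univ_two, Real.dist_eq, sq_abs,
    slant, Matrix.cons_val_zero, Matrix.cons_val_one]
  refine Real.sqrt_le_sqrt ?_
  rcases h with h | h
  · rw [h]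
    linear_combination (p 1 - q 1) ^ 2 * hε
  · rw [h]
    apply le_of_eq
    ring

theorem dominatedOn_slant {c ε : ℝ} (hε : ε ^ 2 = 1) {f : I → Space} (hf : Continuous f)
    {a b : I} (hside : ∀ t, a ≤ t → t ≤ b → |f t 0| = 1 ∨ |f t 1| = 1) :
    DominatedOn (fun t => slant c ε (f t)) f a b := by
  classical
  intro s t has hst htb
  refine edist_comp_le_eVariationOn hf
    {{q | q 0 = 1}, {q | q 0 = -1}, {q | q 1 = 1}, {q | q 1 = -1}} ?_ ?_ s t hst ?_
  · intro A hA
    simp only [Finset.mem_insert, Finset.mem_singleton] at hA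
    rcases hA with rfl | rfl | rfl | rfl <;> exact isClosed_eq (by fun_prop) (by fun_prop)
  · intro A hA p hp q hq
    apply edist_slant_le hε
    simp only [Finset.mem_insert, Finset.mem_singleton] at hA
    rcases hA with rfl | rfl | rfl | rfl
    · exact .inl (hp.trans hq.symm)
    · exact .inl (hp.trans hq.symm)
    · exact .inr (hp.trans hq.symm)
    · exact .inr (hp.trans hq.symm)
  · intro r hr
    rcases hside r (has.trans hr.1) (hr.2.trans htb) with h | h <;>
      rcases eq_or_eq_neg_of_abs_eq h with h | h <;>
      simp [h]

/-- Between the times `a` and `b` the path goes from the source face to the target face on the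
lateral faces. -/
structure IsCrossing {S T : Space} (γ : Path S T) (a b : I) : Prop where
  le : a ≤ b
  surface : IsSurfacePath γ
  start : γ a 2 = -1
  finish : γ b 2 = 1
  side : ∀ t, a ≤ t → t ≤ b → |γ t 0| = 1 ∨ |γ t 1| = 1

/-- `a` is the last time at height -1 and `b` the first later time at height 1. Strictly between
them a surface point has `|x| = 1` or `|y| = 1`, a closed condition that extends to the ends. -/
theorem exists_isCrossing {S T : Space} (hS : S ∈ openSourceFace) (hT : T ∈ openTargetFace)
    {γ : Path S T} (hγ : IsSurfacePath γ) : ∃ a b, IsCrossing γ a b := by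
  have hz : Continuous fun t => γ t 2 := by fun_prop
  obtain ⟨a, ha, hmax⟩ := (isClosed_singleton.preimage hz).isCompact.exists_isGreatest
    (s := (fun t => γ t 2) ⁻¹' {-1}) ⟨0, by simpa using hS.1⟩
  obtain ⟨b, ⟨hb, hab⟩, hmin⟩ :=
    ((isClosed_singleton.preimage hz).inter isClosed_Ici).isCompact.exists_isLeast
    (s := (fun t => γ t 2) ⁻¹' {1} ∩ Ici a) ⟨1, by simpa using hT.1, unitInterval.le_one'⟩
  simp only [mem_preimage, mem_singleton_iff] at ha hb
  have hne : a ≠ b := by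
    rintro rfl
    rw [ha] at hb
    norm_num at hb
  refine ⟨a, b, hab, hγ, ha, hb, ?_⟩
  have hsub : Icc a b ⊆ {t | |γ t 0| = 1} ∪ {t | |γ t 1| = 1} := by
    rw [← closure_Ioo hne]
    refine closure_minimal ?_ ((isClosed_eq (by fun_prop) (by fun_prop)).union
      (isClosed_eq (by fun_prop) (by fun_prop)))
    rintro t ⟨hat, htb⟩
    rcases (mem_cubeSurface.1 (hγ t)).2 with h | h | h
    · exact .inl h
    · exact .inr h
    · rcases eq_or_eq_neg_of_abs_eq h with h | h
      · exact absurd (hmin ⟨h, hat.le⟩) (not_le.2 htb)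
      · exact absurd (hmax h) (not_le.2 hat)
  exact fun t hat htb => hsub ⟨hat, htb⟩

theorem IsCrossing.map {S T : Space} {γ : Path S T} {a b : I} (h : IsCrossing γ a b)
    (g : CubeSymmetry) : IsCrossing (g.path γ) a b where
  le := h.le
  surface := g.isSurfacePath_path h.surface
  start := (g.space_two _).trans h.start
  finish := (g.space_two _).trans h.finish
  side t hat htb := g.space_side (h.side t hat htb)

/-- The path is at least as long as a segment of the unfolding grid, and it unfolds to this segment
if it is shorter than none. -/
def HasGridBound {S T : Space} (γ : Path S T) : Prop :=
  ∃ w ∈ unfoldingGrid, lineLength S T w ≤ pathLength γ ∧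
    ((∀ v ∈ unfoldingGrid, pathLength γ ≤ lineLength S T v) → UnfoldsToLine γ w)

theorem HasGridBound.of_map {S T : Space} {γ : Path S T} (g : CubeSymmetry)
    (h : HasGridBound (g.path γ)) : HasGridBound γ := by
  obtain ⟨w, hw, hle, hline⟩ := h
  have e : ∀ v, lineLength (g.space S) (g.space T) v = lineLength S T (v.map g.dir) := fun v => by
    rw [← g.lineLength_map S T (v.map g.dir), g.map_map]
  rw [e, g.pathLength_path] at hle
  refine ⟨w.map g.dir, g.grid hw, hle, fun hv => g.unfoldsToLine_of_path (hline fun v hv' => ?_)⟩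
  rw [e, g.pathLength_path]
  exact hv _ (g.grid hv')

theorem mem_contactFace_RR_of_surface {q : Space} (hq : q ∈ cubeSurface) (h : q 2 = 1) :
    q ∈ contactFace [R, R] :=
  mem_contactFace_RR.2 ⟨(mem_cubeSurface.1 hq).1.1, (mem_cubeSurface.1 hq).1.2.1, h⟩

theorem convex_abs_le (i : Fin 3) : Convex ℝ {q : Space | |q i| ≤ 1} := by
  have h : {q : Space | |q i| ≤ 1} =
      (EuclideanSpace.proj i : Space →L[ℝ] ℝ).toLinearMap ⁻¹' Icc (-1) 1 := by
    ext q
    simp [abs_le]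
  rw [h]
  exact (convex_Icc _ _).linear_preimage _

theorem convex_eq (i : Fin 3) (c : ℝ) : Convex ℝ {q : Space | q i = c} := by
  have h : {q : Space | q i = c} = (EuclideanSpace.proj i : Space →L[ℝ] ℝ).toLinearMap ⁻¹' {c} := by
    ext q
    simp
  rw [h]
  exact (convex_singleton _).linear_preimage _

theorem convex_contactFace_nil : Convex ℝ (contactFace []) := by
  have : contactFace [] = {q | |q 0| ≤ 1} ∩ ({q | |q 1| ≤ 1} ∩ {q | q 2 = -1}) := by
    ext q
    exact mem_contactFace_nil
  rw [this]
  exact (convex_abs_le 0).inter ((convex_abs_le 1).inter (convex_eq 2 (-1)))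

theorem convex_contactFace_R : Convex ℝ (contactFace [R]) := by
  have : contactFace [R] = {q | q 0 = 1} ∩ ({q | |q 1| ≤ 1} ∩ {q | |q 2| ≤ 1}) := by
    ext q
    exact mem_contactFace_R
  rw [this]
  exact (convex_eq 0 1).inter ((convex_abs_le 1).inter (convex_abs_le 2))

theorem convex_contactFace_RR : Convex ℝ (contactFace [R, R]) := by
  have : contactFace [R, R] = {q | |q 0| ≤ 1} ∩ ({q | |q 1| ≤ 1} ∩ {q | q 2 = 1}) := by
    ext q
    exact mem_contactFace_RR
  rw [this]
  exact (convex_abs_le 0).inter ((convex_abs_le 1).inter (convex_eq 2 1))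

/-- Curves that agree at the times `a` and `b` can be joined. -/
theorem exists_join {E : Type*} [PseudoEMetricSpace E] {f : I → E} {g₀ g₁ g₂ : I → Plane} {a b : I}
    (hab : a ≤ b) (c₀ : Continuous g₀) (c₁ : Continuous g₁) (c₂ : Continuous g₂)
    (d₀ : DominatedOn g₀ f 0 a) (d₁ : DominatedOn g₁ f a b) (d₂ : DominatedOn g₂ f b 1)
    (ea : g₀ a = g₁ a) (eb : g₁ b = g₂ b) :
    ∃ g : I → Plane, Continuous g ∧ DominatedOn g f 0 1 ∧ (∀ t ≤ a, g t = g₀ t) ∧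
      (∀ t, a ≤ t → t ≤ b → g t = g₁ t) ∧ ∀ t, b ≤ t → g t = g₂ t := by
  classical
  let g : I → Plane := fun t => if t ≤ a then g₀ t else if t ≤ b then g₁ t else g₂ t
  have h₀ : ∀ t ≤ a, g t = g₀ t := fun t ht => if_pos ht
  have h₁ : ∀ t, a ≤ t → t ≤ b → g t = g₁ t := fun t hat htb => by
    rcases hat.eq_or_lt with rfl | h
    · rw [h₀ a le_rfl, ea]
    · simp only [g, if_neg (not_le.2 h), if_pos htb]
  have h₂ : ∀ t, b ≤ t → g t = g₂ t := fun t hbt => by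
    rcases hbt.eq_or_lt with rfl | h
    · rw [h₁ b hab le_rfl, eb]
    · simp only [g, if_neg (not_le.2 h), if_neg (not_le.2 (hab.trans_lt h))]
  refine ⟨g, ?_, ?_, h₀, h₁, h₂⟩
  · refine Continuous.if_le c₀ (Continuous.if_le c₁ c₂ continuous_id continuous_const ?_)
      continuous_id continuous_const ?_
    · rintro t rfl
      exact eb
    · rintro t rfl
      rw [if_pos hab, ea]
  · exact ((d₀.congr fun t _ => h₀ t).trans (d₁.congr h₁)).trans (d₂.congr fun t h _ => h₂ t h)

/-- The part of the argument common to RR and RUR: `ha` and `hb` join the development `f` to the two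
projections, and `hmid` is what remains to be shown of the middle stretch in the case of equality.
-/
theorem IsCrossing.hasGridBound_of_development {S T : Space} (hS : S ∈ openSourceFace)
    (hT : T ∈ openTargetFace) {γ : Path S T} {a b : I} (h : IsCrossing γ a b)
    {w : List Dir} (hw : w ∈ unfoldingGrid) (hface : contactFace w = contactFace [R, R])
    (hne : imprint [] S ≠ imprint w T) {f : I → Plane} (hf : Continuous f)
    (hdom : DominatedOn f γ a b) (ha : imprint [] (γ a) = f a) (hb : f b = imprint w (γ b))
    (hmid : eVariationOn γ (Icc a b) ≤ edist (f a) (f b) →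
      (∀ t, a ≤ t → t ≤ b → f t ∈ segment ℝ (imprint [] S) (imprint w T)) →
      ∀ t, a ≤ t → t ≤ b → UnfoldsTo w (γ t) (f t)) :
    HasGridBound γ := by
  obtain ⟨g, hg, hgdom, g₀, g₁, g₂⟩ := exists_join (f := γ) h.le
    ((continuous_imprint []).comp γ.continuous) hf ((continuous_imprint w).comp γ.continuous)
    (.of_edist_le _ _ fun s t => edist_imprint_le _ _ _) hdom
    (.of_edist_le _ _ fun s t => edist_imprint_le _ _ _) ha hb
  have e₀ : g 0 = imprint [] S := by simp [g₀ 0 unitInterval.nonneg']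
  have e₁ : g 1 = imprint w T := by simp [g₂ 1 unitInterval.le_one']
  have el : lineLength S T w = edist (g 0) (g 1) := by rw [lineLength, e₀, e₁, edist_dist]
  refine ⟨w, hw, ?_, fun hle => ?_⟩
  · rw [el]
    exact (hgdom 0 1 le_rfl unitInterval.nonneg' le_rfl).trans
      (eVariationOn.mono _ (subset_univ _))
  have hlen : eVariationOn γ univ ≤ edist (g 0) (g 1) := (hle w hw).trans_eq el
  obtain ⟨φ, h₁, h₂, h₃, h₄, h₅⟩ := hgdom.exists_lineMap hlen hg (by rwa [e₀, e₁])
  rw [e₀, e₁] at h₅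
  refine ⟨φ, h₁, h₂, h₃, h₄, fun t => ?_⟩
  rw [← h₅]
  have htight := fun {s t : I} (hst : s ≤ t) => hgdom.eVariationOn_le_edist hlen hst
  rcases le_total t a with hta | hat
  -- The projection does not increase distances, so the tight bound makes `γ` itself a segment in
  -- space, which stays in the convex source face.
  · have hseg := mem_segment_of_eVariationOn_le (f := γ) (a := 0) (b := a) (t := t)
      ((htight unitInterval.nonneg').trans (by
        rw [g₀ 0 unitInterval.nonneg', g₀ a le_rfl]
        exact edist_imprint_le _ _ _)) unitInterval.nonneg' hta
    refine ⟨[], List.nil_prefix, convex_contactFace_nil.segment_subset ?_ ?_ hseg, (g₀ t hta).symm⟩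
    · exact ⟨h.surface 0, by simpa [rolled] using hS.1⟩
    · exact ⟨h.surface a, h.start⟩
  rcases le_total t b with htb | hbt
  · rw [g₁ t hat htb]
    refine hmid ?_ (fun r har hrb => ?_) t hat htb
    · rw [← g₁ a le_rfl h.le, ← g₁ b h.le le_rfl]
      exact htight h.le
    · rw [← g₁ r har hrb, h₅, segment_eq_image_lineMap]
      exact ⟨φ r, (φ r).2, rfl⟩
  · have hseg := mem_segment_of_eVariationOn_le (f := γ) (a := b) (b := 1) (t := t)
      ((htight unitInterval.le_one').trans (by
        rw [g₂ 1 unitInterval.le_one', g₂ b le_rfl]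
        exact edist_imprint_le _ _ _)) hbt unitInterval.le_one'
    refine ⟨w, List.prefix_rfl, ?_, (g₂ t hbt).symm⟩
    rw [hface]
    refine convex_contactFace_RR.segment_subset ?_ ?_ hseg
    · exact mem_contactFace_RR_of_surface (h.surface b) h.finish
    · exact mem_contactFace_RR_of_surface (h.surface 1) (by simpa using hT.1)

section

variable {S T : Space} (hS : S ∈ openSourceFace) (hT : T ∈ openTargetFace) {γ : Path S T} {a b : I}
  (h : IsCrossing γ a b)
include hS hT h

/-- Projection to the face `x = 1` develops the stretch, whatever faces it visits. In the case of
equality the stretch is a segment between two points of this convex face. -/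
theorem hasGridBound_RR (ha : γ a 0 = 1) (hb : γ b 0 = 1) : HasGridBound γ := by
  have hS' := abs_lt.1 hS.2.1
  have hT' := abs_lt.1 hT.2.1
  refine h.hasGridBound_of_development hS hT (w := [R, R]) (by simp [unfoldingGrid]) rfl ?_
    ((continuous_imprint [R]).comp γ.continuous)
    (.of_edist_le _ _ fun s t => edist_imprint_le _ _ _) ?_ ?_ ?_
  · intro e
    have := congrFun (congrArg WithLp.ofLp e) 0
    rw [imprint_nil, imprint_RR] at this
    simp only [Matrix.cons_val_zero] at this
    linarith
  · rw [Function.comp_apply, imprint_nil, imprint_R]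
    exact plane_ext (by norm_num [ha, h.start]) rfl
  · rw [Function.comp_apply, imprint_RR, imprint_R]
    exact plane_ext (by norm_num [hb, h.finish]) rfl
  · intro hle _ t hat htb
    have mem : ∀ r, γ r 0 = 1 → γ r ∈ contactFace [R] := fun r hr =>
      mem_contactFace_R.2 ⟨hr, (mem_cubeSurface.1 (h.surface r)).1.2⟩
    refine ⟨[R], by decide, convex_contactFace_R.segment_subset (mem a ha) (mem b hb) ?_, rfl⟩
    exact mem_segment_of_eVariationOn_le (hle.trans (edist_imprint_le _ _ _)) hat htb

/-- `slant 1 1` agrees with `imprint [R]` on the face `x = 1` and with `imprint [R, U]` on `y = 1`.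
The other two lateral faces are folded onto the same two squares, so in the case of equality the
path must be shown to avoid them. -/
theorem hasGridBound_RU (ha : γ a 0 = 1) (hb : γ b 1 = 1) : HasGridBound γ := by
  have hS' := abs_lt.1 hS.2.1
  have hT' := abs_lt.1 hT.2.2
  have hc : Continuous fun t => slant 1 1 (γ t) := (continuous_slant 1 1).comp γ.continuous
  refine h.hasGridBound_of_development hS hT (w := [R, U, R]) (by simp [unfoldingGrid]) contactFace_RUR ?_ hc
    (dominatedOn_slant (by norm_num) γ.continuous h.side) ?_ ?_ ?_
  · intro e
    have := congrFun (congrArg WithLp.ofLp e) 0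
    rw [imprint_nil, imprint_RUR] at this
    simp only [Matrix.cons_val_zero] at this
    linarith
  · rw [imprint_nil, slant]
    exact plane_ext (by norm_num [ha, h.start]) (by simp [ha])
  · rw [imprint_RUR, slant]
    exact plane_ext (by norm_num [hb, h.finish]) (by simp [hb]; ring)
  · intro _ hseg
    -- On the lateral faces `x + y = 0` holds only on the vertical edges over (1,-1) and (-1,1), the
    -- fold lines. They are developed to second coordinates -1 and 3, which the segment does not
    -- reach. By continuity `x + y` then keeps the sign it has at `a`.
    have hne : ∀ t, a ≤ t → t ≤ b → γ t 0 + γ t 1 ≠ 0 := by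
      intro t hat htb h0
      obtain ⟨⟨-, -, h₁, h₂⟩, -⟩ := segment_RUR_bounds hS hT (hseg t hat htb)
      simp only [slant, Matrix.cons_val_one, Matrix.cons_val_zero] at h₁ h₂
      rcases h.side t hat htb with h | h <;> rcases eq_or_eq_neg_of_abs_eq h with h | h <;>
        linarith
    have hpos : ∀ t, a ≤ t → t ≤ b → 0 < γ t 0 + γ t 1 := by
      intro t hat htb
      by_contra! hlt
      have hcont : Continuous fun t => γ t 0 + γ t 1 := by fun_prop
      have h0 : 0 ≤ γ a 0 + γ a 1 := by
        have := (abs_le.1 (mem_cubeSurface.1 (h.surface a)).1.2.1).1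
        linarith
      obtain ⟨r, hr, hr0⟩ := (isPreconnected_Icc (a := a) (b := t)).intermediate_value
        (right_mem_Icc.2 hat) (left_mem_Icc.2 hat) hcont.continuousOn ⟨hlt, h0⟩
      exact hne r hr.1 (hr.2.trans htb) hr0
    intro t hat htb
    have hp := hpos t hat htb
    obtain ⟨⟨h₀, h₁, h₂⟩, -⟩ := mem_cubeSurface.1 (h.surface t)
    have l₀ := abs_le.1 h₀
    have l₁ := abs_le.1 h₁
    have hcase : γ t 0 = 1 ∨ γ t 1 = 1 := by
      rcases h.side t hat htb with h | h <;> rcases eq_or_eq_neg_of_abs_eq h with h | h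
      · exact .inl h
      · linarith
      · exact .inr h
      · linarith
    rcases hcase with e | e
    · refine ⟨[R], by decide, mem_contactFace_R.2 ⟨e, h₁, h₂⟩, ?_⟩
      rw [imprint_R, slant]
      exact plane_ext rfl (by simp [e])
    · refine ⟨[R, U], by decide, mem_contactFace_RU.2 ⟨e, h₀, h₂⟩, ?_⟩
      rw [imprint_RU, slant]
      exact plane_ext rfl (by simp [e]; ring)

/-- The stretch passes the face `y = 1`, where `slant 1 1` and `slant 3 (-1)` agree. Changing from
one to the other at `m` compares the path with the segment of RUUR. -/
theorem hasGridBound_RL_of_U (ha : γ a 0 = 1) (hb : γ b 0 = -1) {m : I} (ham : a ≤ m)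
    (hmb : m ≤ b) (hm₀ : γ m 0 = 0) (hm₁ : γ m 1 = 1) : HasGridBound γ := by
  have hlt : lineLength S T [U, U] < pathLength γ := by
    refine (lineLength_UU_lt hS hT).trans_le ?_
    have d₁ := dominatedOn_slant (c := 1) (ε := 1) (by norm_num) γ.continuous
      (fun t h₁ h₂ => h.side t h₁ (h₂.trans hmb)) a m le_rfl ham le_rfl
    have d₂ := dominatedOn_slant (c := 3) (ε := -1) (by norm_num) γ.continuous
      (fun t h₁ h₂ => h.side t (ham.trans h₁) h₂) m b le_rfl hmb le_rfl
    have d₀ := (edist_imprint_le [] (γ 0) (γ a)).trans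
      (edist_le_eVariationOn_Icc γ unitInterval.nonneg')
    have d₃ := (edist_imprint_le [R, U, U, R] (γ b) (γ 1)).trans
      (edist_le_eVariationOn_Icc γ unitInterval.le_one')
    have e₁ : imprint [] (γ a) = slant 1 1 (γ a) := by
      rw [imprint_nil, slant]
      exact plane_ext (by norm_num [ha, h.start]) (by simp [ha])
    have e₂ : slant 1 1 (γ m) = slant 3 (-1) (γ m) := by
      rw [slant, slant]
      exact plane_ext rfl (by norm_num [hm₀, hm₁])
    have e₃ : slant 3 (-1) (γ b) = imprint [R, U, U, R] (γ b) := by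
      rw [imprint_RUUR, slant]
      exact plane_ext (by norm_num [hb, h.finish]) (by simp [hb]; ring)
    rw [γ.source] at d₀
    rw [γ.target] at d₃
    have hI : Icc (0 : I) 1 = univ := by
      ext x
      simp [unitInterval.le_one']
    rw [lineLength, ← edist_dist, pathLength, ← hI,
      ← eVariationOn_Icc_add γ (unitInterval.nonneg' (t := a)) unitInterval.le_one',
      ← eVariationOn_Icc_add γ ham (unitInterval.le_one' (t := m)),
      ← eVariationOn_Icc_add γ hmb (unitInterval.le_one' (t := b))]
    refine (edist_triangle _ (imprint [] (γ a)) _).trans (add_le_add d₀ ?_)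
    rw [e₁]
    refine (edist_triangle _ (slant 1 1 (γ m)) _).trans (add_le_add d₁ ?_)
    rw [e₂]
    refine (edist_triangle _ (slant 3 (-1) (γ b)) _).trans (add_le_add d₂ ?_)
    rw [e₃]
    exact d₃
  have hUU : [U, U] ∈ unfoldingGrid := by simp [unfoldingGrid]
  -- The inequality is strict, so the premise of the clause on equality fails for UU.
  exact ⟨_, hUU, hlt.le, fun hv => absurd (hv _ hUU) (not_le.2 hlt)⟩

theorem hasGridBound_RL (ha : γ a 0 = 1) (hb : γ b 0 = -1) : HasGridBound γ := by
  have hcont : Continuous fun t => γ t 0 := by fun_prop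
  obtain ⟨m, ⟨ham, hmb⟩, hm⟩ := (isPreconnected_Icc (a := a) (b := b)).intermediate_value
    (right_mem_Icc.2 h.le) (left_mem_Icc.2 h.le) hcont.continuousOn
    (show (0 : ℝ) ∈ Icc (γ b 0) (γ a 0) by rw [ha, hb]; norm_num)
  simp only at hm
  have h₁ : |γ m 1| = 1 := (h.side m ham hmb).resolve_left (by rw [hm]; norm_num)
  rcases eq_or_eq_neg_of_abs_eq h₁ with h₁ | h₁
  · exact hasGridBound_RL_of_U hS hT h ha hb ham hmb hm h₁
  · refine .of_map .flipY (hasGridBound_RL_of_U (CubeSymmetry.source _ hS)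
      (CubeSymmetry.target _ hT) (h.map .flipY) ha hb ham hmb hm ?_)
    change -γ m 1 = 1
    rw [h₁, neg_neg]

theorem hasGridBound_R (ha : γ a 0 = 1) : HasGridBound γ := by
  rcases h.side b h.le le_rfl with hb | hb <;> rcases eq_or_eq_neg_of_abs_eq hb with hb | hb
  · exact hasGridBound_RR hS hT h ha hb
  · exact hasGridBound_RL hS hT h ha hb
  · exact hasGridBound_RU hS hT h ha hb
  · refine .of_map .flipY (hasGridBound_RU (CubeSymmetry.source _ hS)
      (CubeSymmetry.target _ hT) (h.map .flipY) ha ?_)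
    change -γ b 1 = 1
    rw [hb, neg_neg]

theorem hasGridBound_R_or_L (ha : |γ a 0| = 1) : HasGridBound γ := by
  rcases eq_or_eq_neg_of_abs_eq ha with ha | ha
  · exact hasGridBound_R hS hT h ha
  · refine .of_map .flipX (hasGridBound_R (CubeSymmetry.source _ hS)
      (CubeSymmetry.target _ hT) (h.map .flipX) ?_)
    change -γ a 0 = 1
    rw [ha, neg_neg]

theorem IsCrossing.hasGridBound : HasGridBound γ := by
  rcases h.side a le_rfl h.le with ha | ha
  · exact hasGridBound_R_or_L hS hT h ha
  · exact .of_map .swap (hasGridBound_R_or_L (CubeSymmetry.source _ hS)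
      (CubeSymmetry.target _ hT) (h.map .swap) ha)

end

theorem IsSurfacePath.hasGridBound {S T : Space} (hS : S ∈ openSourceFace)
    (hT : T ∈ openTargetFace) {γ : Path S T} (hγ : IsSurfacePath γ) : HasGridBound γ := by
  obtain ⟨a, b, h⟩ := exists_isCrossing hS hT hγ
  exact h.hasGridBound hS hT

/-! ### Conclusion -/

theorem exists_shortest_in_grid (S T : Space) :
    ∃ w ∈ unfoldingGrid, ∀ v ∈ unfoldingGrid, lineLength S T w ≤ lineLength S T v := by
  have hfin : unfoldingGrid.Finite := by
    have : unfoldingGrid = {w | w ∈ gridList} := by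
      ext w
      exact mem_gridList.symm
    rw [this]
    exact gridList.finite_toSet
  exact exists_min_image _ (lineLength S T) hfin ⟨[R, R], by simp [unfoldingGrid]⟩

end CubeUnfolding
end

open CubeUnfolding
theorem mainTheorem3 (S T : Space) (hS : S ∈ openSourceFace) (hT : T ∈ openTargetFace) :
    -- a shortest path exists
    (∃ γ : Path S T, IsShortestPath γ) ∧
    -- every shortest path unfolds to a straight line in the interior of some partial unfolding
    (∀ γ : Path S T, IsShortestPath γ →
      ∃ w ∈ unfoldingGrid, IsLSPath S T w ∧ UnfoldsToLine γ w) ∧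
    -- the shortest distance is the least length of an LS-path
    IsLeast {l | ∃ w, IsLSPath S T w ∧ l = lineLength S T w} (surfaceDist S T) ∧
    -- it is also the least length of an LS-path of the unfolding grid
    IsLeast {l | ∃ w ∈ unfoldingGrid, IsLSPath S T w ∧ l = lineLength S T w}
      (surfaceDist S T) ∧
    -- and the least of the twelve lengths of LS-paths or pseudopaths of the unfolding grid
    IsLeast {l | ∃ w ∈ unfoldingGrid, l = lineLength S T w} (surfaceDist S T) := by
  obtain ⟨w, hw, hmin⟩ := exists_shortest_in_grid S T
  obtain ⟨hLS, γ, hγ, hγw⟩ := realizedIfShortest hw S T hS hT hmin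
  have hlow : ∀ γ' : Path S T, IsSurfacePath γ' → lineLength S T w ≤ pathLength γ' := by
    intro γ' hγ'
    obtain ⟨v, hv, hle, -⟩ := hγ'.hasGridBound hS hT
    exact (hmin v hv).trans hle
  have hdist : surfaceDist S T = lineLength S T w :=
    le_antisymm ((iInf₂_le γ hγ).trans hγw) (le_iInf₂ hlow)
  refine ⟨⟨γ, hγ, fun γ' hγ' => hγw.trans (hlow γ' hγ')⟩, ?_, ?_, ?_, ?_⟩
  · rintro δ ⟨hδ, hshort⟩
    have hδw : pathLength δ ≤ lineLength S T w := (hshort γ hγ).trans hγw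
    obtain ⟨v, hv, hle, hline⟩ := hδ.hasGridBound hS hT
    refine ⟨v, hv, ?_, hline fun u hu => hδw.trans (hmin u hu)⟩
    -- The segment of `v` is no longer than the shortest path `δ`, hence is itself shortest in the
    -- grid and an LS-path.
    exact (realizedIfShortest hv S T hS hT fun u hu =>
      hle.trans (hδw.trans (hmin u hu))).1
  · refine ⟨⟨w, hLS, hdist⟩, ?_⟩
    rintro _ ⟨v, hv, rfl⟩
    obtain ⟨u, hu, hle⟩ := hv.1.boundedByGrid S T hS hT
    rw [hdist]
    exact (hmin u hu).trans hle
  · refine ⟨⟨w, hw, hLS, hdist⟩, ?_⟩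
    rintro _ ⟨v, hv, -, rfl⟩
    rw [hdist]
    exact hmin v hv
  · refine ⟨⟨w, hw, hdist⟩, ?_⟩
    rintro _ ⟨v, hv, rfl⟩
    rw [hdist]
    exact hmin v hv
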